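/- Let $m\ge 1$ be a fixed integer and let $a_1,\dots,a_m>0$ be constants with $\sum_{i=1}^m a_i=1$. For every $n\ge 1$ let $P_n$ and $1\le K_{1,n}\le K_{2,n}\le\dots\le K_{m,n}\le P_n$ be integers. The heterogeneous random key graph $\mathbb G(n,\vec a,\vec K_n,P_n)$ is the random graph on $n$ nodes in which each node independently joins exactly one of $m$ groups, group $i$ with probability $a_i$; given the groups, each node of group $i$ independently picks a uniformly random set of $K_{i,n}$ distinct keys from a pool of $P_n$ keys; and two distinct nodes are adjacent if and only if they share at least one key. Suppose that, as $n\to\infty$, $P_n=\Omega(n)$, $K_{1,n}=\omega\big(\sqrt{P_n/n}\big)$ and $K_{m,n}=o\big(\sqrt{P_n}\big)$. Define the sequence $\beta_n$ by $$\sum_{j=1}^m a_j\left[1-\binom{P_n-K_{1,n}}{K_{j,n}}\Big/\binom{P_n}{K_{j,n}}\right]=\frac{\ln n+\beta_n}{n}.$$ Then $$\lim_{n\to\infty}\mathbb P\big[\mathbb G(n,\vec a,\vec K_n,P_n)\text{ is connected}\big]=\begin{cases}0,&\text{if }\lim_{n\to\infty}\beta_n=-\infty,\\ 1,&\text{if }\lim_{n\to\infty}\beta_n=+\infty.\end{cases}$$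 -/

import Mathlib

open Filter Topology Asymptotics

namespace RandomKeyGraph

/-- An outcome of the key predistribution on `n` nodes with `m` groups and a pool of `P` keys:
each node receives a group and a key ring. -/
abbrev Outcome (n m P : ℕ) : Type := Fin n → Fin m × Finset (Fin P)

/-- The law of one node: it joins group `i` with probability `a i`, and then its key ring is
uniform among the `K i`-element subsets of the pool. -/
noncomputable def nodeWeight {m : ℕ} (a : Fin m → ℝ) (K : Fin m → ℕ) (P : ℕ)
    (x : Fin m × Finset (Fin P)) : ℝ :=
  if x.2.card = K x.1 then a x.1 * (1 / (P.choose (K x.1) : ℝ)) else 0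

/-- The law of all nodes: the nodes are independent. -/
noncomputable def weight (n : ℕ) {m : ℕ} (a : Fin m → ℝ) (K : Fin m → ℕ) (P : ℕ)
    (ω : Outcome n m P) : ℝ :=
  ∏ v, nodeWeight a K P (ω v)

open Classical in
/-- The probability of an event. -/
noncomputable def prob (n : ℕ) {m : ℕ} (a : Fin m → ℝ) (K : Fin m → ℕ) (P : ℕ)
    (E : Set (Outcome n m P)) : ℝ :=
  ∑ ω : Outcome n m P, if ω ∈ E then weight n a K P ω else 0

/-- The graph of an outcome: two distinct nodes are adjacent iff they share at least one key. -/
def graph {n m P : ℕ} (ω : Outcome n m P) : SimpleGraph (Fin n) where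
  Adj u v := u ≠ v ∧ ((ω u).2 ∩ (ω v).2).Nonempty
  symm := ⟨fun u v h => ⟨h.1.symm, by rw [Finset.inter_comm]; exact h.2⟩⟩
  loopless := ⟨fun _ h => h.1 rfl⟩

/-- The probability that the heterogeneous random key graph `G(n, a, K, P)` is connected. -/
noncomputable def connProb (n : ℕ) {m : ℕ} (a : Fin m → ℝ) (K : Fin m → ℕ) (P : ℕ) : ℝ :=
  prob n a K P {ω | (graph ω).Connected}

/-- The law of one node is normalized. -/
theorem sum_nodeWeight {m : ℕ} (a : Fin m → ℝ) (ha : ∑ i, a i = 1) (K : Fin m → ℕ) (P : ℕ)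
    (hK : ∀ i, K i ≤ P) : ∑ x, nodeWeight a K P x = 1 := by
  rw [Fintype.sum_prod_type, ← ha]
  refine Finset.sum_congr rfl fun i _ => ?_
  have h0 : (P.choose (K i) : ℝ) ≠ 0 := by
    exact_mod_cast (Nat.choose_pos (hK i)).ne'
  have hc : (Finset.univ.filter fun S : Finset (Fin P) => S.card = K i).card
      = P.choose (K i) := by
    rw [Finset.univ_filter_card_eq, Finset.card_powersetCard, Finset.card_univ, Fintype.card_fin]
  simp only [nodeWeight]
  rw [← Finset.sum_filter, Finset.sum_const, hc, nsmul_eq_mul]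
  field_simp

/-- The total probability is one. -/
theorem prob_univ (n : ℕ) {m : ℕ} (a : Fin m → ℝ) (ha : ∑ i, a i = 1) (K : Fin m → ℕ) (P : ℕ)
    (hK : ∀ i, K i ≤ P) : prob n a K P Set.univ = 1 := by
  simp only [prob, Set.mem_univ, if_true, weight]
  rw [← Fintype.prod_sum (fun (_ : Fin n) x => nodeWeight a K P x)]
  simp [sum_nodeWeight a ha K P hK]

end RandomKeyGraph

/-! Write k for the smallest ring size, q(u) = `avoidProb` for the chance that a random node misses
a given set of u keys, λ = 1 - q(k) = (log n + β)/n, and b for the least group probability.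

Zero law: let X count the isolated nodes of the first group. Its mean μ = n a q(k)^(n-1) is at least
about a exp(-β), which tends to infinity. Two isolated nodes have disjoint rings, so a pair is
governed by q(2k), and q(2k) ≤ q(k)² + λ²/b (`avoidProb_two_mul_le`) makes the pairs asymptotically
uncorrelated. Chebyshev (`connProb_le`) then forces X > 0, hence disconnection, with high
probability.

One law: a disconnected graph has a set of r ≤ n/2 nodes sharing no key with the rest. Given the
union U of its rings, this has probability q(|U|)^(n-r). Shrinking every ring to size k only
increases the average (`ringAvg_le_of_le`), so `one_sub_connProb_le` reduces the claim to a sum over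
r of C(n,r) E[q(|U|)^(n-r)] with U a union of r uniform k-rings. If q(u)^(n-r) ≤ y^u with y =
exp(-θ) for u ≤ rk, adding the rings one at a time (`iterAvg_cutoff_le`) bounds the expectation by
(y + (1-y) rk/P)^(kr): a new key is either fresh or already covered.

What remains is the choice of θ. The linear rate (n-r)k/P serves when n/r is moderate. Otherwise
concavity of 1 - q gives a rate through `hitBound`, which is about rλ while that is small. Only when
r is a small power below n and β = O(log n) is the sharp exponent needed
(`choose_mul_iterAvg_le_of_fine`); there a term is at most exp(2-β)^r. If rk exceeds P/4, U almost
surely covers a fixed fraction of the pool (`choose_mul_iterAvg_le_of_large`). Every term is at most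
2ε^r, and the geometric series finishes. -/

namespace RandomKeyGraph

/-! ### The probability that a random ring misses a given set of keys -/

/-- The probability that a uniformly random `K`-element ring misses a given set of `u` keys. -/
noncomputable def missProb (P K u : ℕ) : ℝ := ((P - u).choose K : ℝ) / (P.choose K : ℝ)

theorem missProb_nonneg (P K u : ℕ) : 0 ≤ missProb P K u := by unfold missProb; positivity

theorem missProb_antitone (P K : ℕ) : Antitone (missProb P K) := by
  intro u v h
  unfold missProb
  have : (P - v).choose K ≤ (P - u).choose K := Nat.choose_le_choose K (by omega)
  gcongr

theorem missProb_zero {P K : ℕ} (h : K ≤ P) : missProb P K 0 = 1 := by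
  have := Nat.choose_pos h
  unfold missProb
  rw [Nat.sub_zero, div_self (by positivity)]

theorem missProb_le_one (P K u : ℕ) : missProb P K u ≤ 1 := by
  unfold missProb
  have : (P - u).choose K ≤ P.choose K := Nat.choose_le_choose K (by omega)
  exact div_le_one_of_le₀ (by exact_mod_cast this) (by positivity)

/-- Missing two disjoint key sets is negatively correlated. Factor by factor, (P-u-i)(P-v-i) exceeds
(P-u-v-i)(P-i) by uv. -/
theorem missProb_add_le {P K : ℕ} (h : K ≤ P) (u v : ℕ) :
    missProb P K (u + v) ≤ missProb P K u * missProb P K v := by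
  have hpos : (0 : ℝ) < P.choose K := by exact_mod_cast Nat.choose_pos h
  have key : (P - (u + v)).choose K * P.choose K ≤ (P - u).choose K * (P - v).choose K := by
    have hd : (P - (u + v)).descFactorial K * P.descFactorial K ≤
        (P - u).descFactorial K * (P - v).descFactorial K := by
      simp only [Nat.descFactorial_eq_prod_range, ← Finset.prod_mul_distrib]
      refine Finset.prod_le_prod' fun i _ => ?_
      -- Truncated subtraction makes the left factor vanish here; otherwise all differences are
      -- genuine.
      by_cases hi : P ≤ u + v + i
      · rw [show P - (u + v) - i = 0 by omega]; simp
      · obtain ⟨t, rfl⟩ := Nat.exists_eq_add_of_le (not_le.mp hi).le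
        rw [show u + v + i + t - (u + v) - i = t by omega,
          show u + v + i + t - i = u + v + t by omega,
          show u + v + i + t - u - i = v + t by omega,
          show u + v + i + t - v - i = u + t by omega]
        nlinarith [Nat.zero_le (u * v)]
    simp only [Nat.descFactorial_eq_factorial_mul_choose] at hd
    have hf := Nat.factorial_pos K
    have : (K.factorial * K.factorial) * ((P - (u + v)).choose K * P.choose K) ≤
        (K.factorial * K.factorial) * ((P - u).choose K * (P - v).choose K) := by
      linarith
    exact Nat.le_of_mul_le_mul_left this (by positivity)
  unfold missProb
  rw [div_mul_div_comm, div_le_div_iff₀ hpos (by positivity)]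
  have key' : ((P - (u + v)).choose K : ℝ) * P.choose K ≤
    (P - u).choose K * (P - v).choose K := by exact_mod_cast key
  nlinarith

theorem missProb_mul_le {P K : ℕ} (h : K ≤ P) (u r : ℕ) :
    missProb P K (r * u) ≤ missProb P K u ^ r := by
  induction r with
  | zero => simpa using missProb_le_one P K 0
  | succ r ih =>
    rw [Nat.succ_mul, pow_succ]
    exact (missProb_add_le h _ _).trans
      (mul_le_mul_of_nonneg_right ih (missProb_nonneg _ _ _))

theorem missProb_one {P K : ℕ} (hP : 0 < P) (h : K ≤ P) : missProb P K 1 = 1 - K / P := by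
  obtain ⟨N, rfl⟩ := Nat.exists_eq_succ_of_ne_zero hP.ne'
  have hpos : (0 : ℝ) < (N + 1).choose K := by exact_mod_cast Nat.choose_pos h
  have h1 := Nat.choose_mul_succ_eq N K
  have h2 : (N.choose K : ℝ) * (N + 1) = (N + 1).choose K * ((N + 1) - K) := by
    have := congrArg (Nat.cast (R := ℝ)) h1
    rw [Nat.cast_mul, Nat.cast_mul, Nat.cast_sub h] at this
    exact_mod_cast this
  unfold missProb
  simp only [Nat.succ_eq_add_one, Nat.add_sub_cancel]
  push_cast
  rw [div_eq_iff hpos.ne']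
  field_simp
  linarith

theorem missProb_le_exp {P K : ℕ} (hP : 0 < P) (h : K ≤ P) (u : ℕ) :
    missProb P K u ≤ Real.exp (-(u * K / P)) := by
  have h1 := missProb_mul_le h 1 u
  rw [mul_one] at h1
  refine h1.trans ?_
  rw [show -((u : ℝ) * K / P) = u * (-(K / P)) by ring, Real.exp_nat_mul]
  refine pow_le_pow_left₀ (missProb_nonneg _ _ _) ?_ u
  rw [missProb_one hP h]
  linarith [Real.add_one_le_exp (-((K : ℝ) / P))]

/-- Convexity in u: by Pascal's rule the drop is C(P-u-1, K-1)/C(P, K), which decreases in u and is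
zero from u = P on. -/
theorem missProb_sub_succ_antitone {P K : ℕ} (hK : 1 ≤ K) :
    Antitone fun u => missProb P K u - missProb P K (u + 1) := by
  obtain ⟨K, rfl⟩ := Nat.exists_eq_add_of_le' hK
  have h : ∀ u, missProb P (K + 1) u - missProb P (K + 1) (u + 1) =
      (if u < P then ((P - u - 1).choose K : ℝ) else 0) / P.choose (K + 1) := by
    intro u
    unfold missProb
    rw [← sub_div]
    congr 1
    split_ifs with hu
    · obtain ⟨t, rfl⟩ := Nat.exists_eq_add_of_lt hu
      rw [show u + t + 1 - u = t + 1 by omega, show u + t + 1 - (u + 1) = t by omega,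
        Nat.choose_succ_succ]
      push_cast
      simp
    · rw [show P - u = 0 by omega, show P - (u + 1) = 0 by omega, sub_self]
  intro u v huv
  simp only [h]
  gcongr
  split_ifs with h1 h2 h2
  · exact_mod_cast Nat.choose_le_choose K (by omega)
  · omega
  · positivity
  · exact le_rfl

/-- A sequence with antitone increments and nonnegative initial value lies above its chords. -/
theorem mul_le_mul_of_antitone_increments {g : ℕ → ℝ} (h0 : 0 ≤ g 0)
    (hg : Antitone fun u => g (u + 1) - g u) {u M : ℕ} (h : u ≤ M) :
    (u : ℝ) * g M ≤ M * g u := by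
  -- The next increment is at most the average of the previous ones, since g starts nonnegative.
  have key : ∀ v : ℕ, (v : ℝ) * (g (v + 1) - g v) ≤ g v := by
    intro v
    induction v with
    | zero => simpa using h0
    | succ v ih =>
      have h1 : g (v + 1 + 1) - g (v + 1) ≤ g (v + 1) - g v := hg (Nat.le_succ v)
      push_cast
      nlinarith [mul_le_mul_of_nonneg_left h1 (show (0 : ℝ) ≤ (v : ℝ) + 1 by positivity)]
  induction M, h using Nat.le_induction with
  | base => exact le_rfl
  | succ M hM ih =>
    rcases Nat.eq_zero_or_pos M with rfl | hMpos
    · obtain rfl : u = 0 := by omega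
      simpa using h0
    · have hM' : (0 : ℝ) < M := by exact_mod_cast hMpos
      have hk := key M
      have hu : (0 : ℝ) ≤ u := by positivity
      push_cast
      have h2 := mul_le_mul_of_nonneg_left hk hu
      have : (M : ℝ) * (u * g (M + 1)) ≤ M * ((M + 1) * g u) := by nlinarith
      exact le_of_mul_le_mul_left this hM'

/-! ### Averages over uniform rings -/

/-- The hypergeometric generating function is dominated by the binomial one. Expanding over subsets
C of B ∩ U and counting the B containing C leaves C(|U|,c)/C(P,c) ≤ (|U|/P)^c, a comparison of
falling factorials. -/
theorem sum_powersetCard_one_add_pow_le {P k : ℕ} (hP : 0 < P) {z : ℝ}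
    (hz : 0 ≤ z) (U : Finset (Fin P)) :
    ∑ B ∈ Finset.powersetCard k Finset.univ, (1 + z) ^ (B ∩ U).card ≤
      P.choose k * (1 + z * (U.card / P)) ^ k := by
  have h1 : ∀ B : Finset (Fin P), (1 + z) ^ (B ∩ U).card =
      ∑ C ∈ (B ∩ U).powerset, z ^ C.card := by
    intro B
    rw [add_comm, ← Finset.sum_pow_mul_eq_add_pow]
    simp
  have h2 : ∑ B ∈ Finset.powersetCard k Finset.univ, (1 + z) ^ (B ∩ U).card =
      ∑ C ∈ U.powerset, ∑ B ∈ (Finset.powersetCard k Finset.univ).filter (C ⊆ ·),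
        z ^ C.card := by
    simp only [h1]
    refine Finset.sum_comm' fun B C => ?_
    simp only [Finset.mem_powerset, Finset.mem_filter, Finset.subset_inter_iff]
    tauto
  rw [h2]
  simp only [Finset.sum_const, nsmul_eq_mul]
  have h3 : ∀ C ∈ U.powerset,
      (((Finset.powersetCard k Finset.univ).filter (C ⊆ ·)).card : ℝ) * z ^ C.card =
      (fun c : ℕ => (if c ≤ k then ((P - c).choose (k - c) : ℝ) else 0) * z ^ c) C.card := by
    intro C _
    simp only
    split_ifs with hc
    · rw [Finset.card_filter_powersetCard_subset _ _ _ (Finset.subset_univ C) hc]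
      simp
    · rw [Finset.filter_eq_empty_iff.2]
      · simp
      · intro B hB hCB
        have := Finset.card_le_card hCB
        rw [Finset.mem_powersetCard] at hB
        omega
  rw [Finset.sum_congr rfl h3, Finset.sum_powerset_apply_card
    (fun c : ℕ => (if c ≤ k then ((P - c).choose (k - c) : ℝ) else 0) * z ^ c)]
  have h4 : ∀ c : ℕ, c ≤ k → (U.card.choose c : ℝ) * (P - c).choose (k - c) ≤
      P.choose k * (k.choose c * (U.card / P : ℝ) ^ c) := by
    intro c hc
    have hU : U.card ≤ P := by simpa using Finset.card_le_univ U
    have e1 : (P.choose k : ℝ) * k.choose c = P.choose c * (P - c).choose (k - c) := by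
      exact_mod_cast Nat.choose_mul (n := P) hc
    rw [← mul_assoc, e1]
    have e2 : (U.card.choose c : ℝ) ≤ P.choose c * (U.card / P : ℝ) ^ c := by
      have : U.card.descFactorial c * P ^ c ≤ P.descFactorial c * U.card ^ c := by
        simp only [Nat.descFactorial_eq_prod_range]
        have e : ∀ N : ℕ, N ^ c = ∏ _i ∈ Finset.range c, N := by simp
        rw [e, e, ← Finset.prod_mul_distrib, ← Finset.prod_mul_distrib]
        refine Finset.prod_le_prod' fun i _ => ?_
        rw [Nat.sub_mul, Nat.sub_mul, mul_comm P]
        exact Nat.sub_le_sub_left (Nat.mul_le_mul_left i hU) _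
      simp only [Nat.descFactorial_eq_factorial_mul_choose] at this
      rw [mul_assoc, mul_assoc] at this
      have := Nat.le_of_mul_le_mul_left this (Nat.factorial_pos c)
      rw [div_pow, ← mul_div_assoc, le_div_iff₀ (by positivity)]
      exact_mod_cast this
    calc (U.card.choose c : ℝ) * (P - c).choose (k - c) ≤
        (P.choose c * (U.card / P : ℝ) ^ c) * (P - c).choose (k - c) := by gcongr
      _ = _ := by ring
  have h5 : (1 + z * (U.card / P : ℝ)) ^ k =
      ∑ c ∈ Finset.range (k + 1), k.choose c * (U.card / P : ℝ) ^ c * z ^ c := by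
    rw [add_comm, add_pow]
    refine Finset.sum_congr rfl fun c _ => ?_
    rw [mul_pow]; ring
  rw [h5, Finset.mul_sum]
  have h6 : ∀ c, U.card.choose c • ((if c ≤ k then ((P - c).choose (k - c) : ℝ) else 0) * z ^ c)
      ≤ if c ∈ Finset.range (k + 1) then
        (P.choose k : ℝ) * (k.choose c * (U.card / P : ℝ) ^ c * z ^ c) else 0 := by
    intro c
    rw [nsmul_eq_mul]
    split_ifs with h h' h'
    · have := mul_le_mul_of_nonneg_right (h4 c h) (pow_nonneg hz c)
      nlinarith
    · simp at h'; omega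
    · simp at h'; omega
    · simp
  refine (Finset.sum_le_sum fun c _ => h6 c).trans ?_
  rw [← Finset.sum_filter]
  refine Finset.sum_le_sum_of_subset_of_nonneg (fun c => by simp) fun c _ _ => by positivity

/-- The average of `F` over the unions of `V` with a uniformly random `k`-element ring. -/
noncomputable def ringAvg {P : ℕ} (k : ℕ) (F : Finset (Fin P) → ℝ) (V : Finset (Fin P)) : ℝ :=
  (∑ B ∈ Finset.powersetCard k Finset.univ, F (V ∪ B)) / P.choose k

/-- The average of `F` over the unions of `V` with `r` independent uniformly random `k`-element
rings. -/
noncomputable def iterAvg {P : ℕ} (k : ℕ) : ℕ → (Finset (Fin P) → ℝ) → Finset (Fin P) → ℝ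
  | 0, F => F
  | r + 1, F => ringAvg k (iterAvg k r F)

theorem ringAvg_const {P k : ℕ} (hk : k ≤ P) (c : ℝ) (V : Finset (Fin P)) :
    ringAvg k (fun _ => c) V = c := by
  have : (0 : ℝ) < P.choose k := by exact_mod_cast Nat.choose_pos hk
  unfold ringAvg
  rw [Finset.sum_const, Finset.card_powersetCard, Finset.card_univ, Fintype.card_fin,
    nsmul_eq_mul]
  field_simp

/-- Adding r rings of size k contributes at most r k keys, so F and G need only be compared up to
that size. -/
theorem iterAvg_le_of_card {P k : ℕ} {r : ℕ} {F G : Finset (Fin P) → ℝ} {V : Finset (Fin P)}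
    (h : ∀ U, U.card ≤ V.card + r * k → F U ≤ G U) : iterAvg k r F V ≤ iterAvg k r G V := by
  induction r generalizing V with
  | zero => exact h V (by omega)
  | succ r ih =>
    unfold iterAvg ringAvg
    gcongr with B hB
    refine ih fun U hU => h U ?_
    have h1 := Finset.card_union_le V B
    rw [Finset.mem_powersetCard] at hB
    rw [Nat.succ_mul]
    omega

theorem iterAvg_mono {P k r : ℕ} {F G : Finset (Fin P) → ℝ} (h : ∀ U, F U ≤ G U)
    (V : Finset (Fin P)) : iterAvg k r F V ≤ iterAvg k r G V :=
  iterAvg_le_of_card fun U _ => h U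

theorem iterAvg_add_const {P k r : ℕ} (hk : k ≤ P) (F : Finset (Fin P) → ℝ) (c : ℝ)
    (V : Finset (Fin P)) : iterAvg k r (fun U => F U + c) V = iterAvg k r F V + c := by
  induction r generalizing V with
  | zero => rfl
  | succ r ih =>
    have hc := ringAvg_const hk c V
    unfold iterAvg
    unfold ringAvg at hc ⊢
    simp only [ih, Finset.sum_add_distrib]
    rw [add_div, hc]

theorem iterAvg_const_mul {P k r : ℕ} (F : Finset (Fin P) → ℝ) (c : ℝ)
    (V : Finset (Fin P)) : iterAvg k r (fun U => c * F U) V = c * iterAvg k r F V := by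
  induction r generalizing V with
  | zero => rfl
  | succ r ih =>
    unfold iterAvg ringAvg
    simp only [ih, ← Finset.mul_sum, mul_div_assoc]

/-- Since |V ∪ B| = |V| + k - |B ∩ V|, this is the generating function bound at 1 + z = 1/y. -/
theorem ringAvg_pow_card_le {P k : ℕ} (hP : 0 < P) (hk : k ≤ P) {y : ℝ} (hy : 0 < y) (hy1 : y ≤ 1)
    (V : Finset (Fin P)) :
    ringAvg k (fun U => y ^ U.card) V ≤ y ^ V.card * (y + (1 - y) * (V.card / P)) ^ k := by
  have hpos : (0 : ℝ) < P.choose k := by exact_mod_cast Nat.choose_pos hk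
  have hz : 0 ≤ 1 / y - 1 := by rw [sub_nonneg, le_div_iff₀ hy]; linarith
  have h := sum_powersetCard_one_add_pow_le (k := k) hP hz V
  unfold ringAvg
  rw [div_le_iff₀ hpos]
  have e1 : ∀ B ∈ Finset.powersetCard k Finset.univ, y ^ (V ∪ B).card =
      (y ^ V.card * y ^ k) * (1 + (1 / y - 1)) ^ (B ∩ V).card := by
    intro B hB
    rw [Finset.mem_powersetCard] at hB
    have := Finset.card_union_add_card_inter V B
    rw [hB.2, Finset.inter_comm] at this
    rw [← pow_add, ← this, pow_add, add_sub_cancel, one_div, inv_pow]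
    field_simp
  rw [Finset.sum_congr rfl e1, ← Finset.mul_sum]
  have e2 : (y + (1 - y) * ((V.card : ℝ) / P)) ^ k =
      y ^ k * (1 + (1 / y - 1) * (V.card / P)) ^ k := by
    rw [← mul_pow]; congr 1; field_simp
  rw [e2]
  calc _ ≤ (y ^ V.card * y ^ k) * (P.choose k * (1 + (1 / y - 1) * (V.card / P : ℝ)) ^ k) := by
        gcongr
    _ = _ := by ring

-- Unions only grow, so a set already above M contributes nothing. Every step therefore starts from
-- |V| ≤ M, which makes the contraction factor uniform.
open Classical in
theorem iterAvg_cutoff_le {P k : ℕ} (hP : 0 < P) (hk : k ≤ P) {y : ℝ} (hy : 0 < y) (hy1 : y ≤ 1)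
    {M : ℝ} (hM : 0 ≤ M) (r : ℕ) (V : Finset (Fin P)) :
    iterAvg k r (fun U => if (U.card : ℝ) ≤ M then y ^ U.card else 0) V ≤
      (y + (1 - y) * (M / P)) ^ (k * r) * (if (V.card : ℝ) ≤ M then y ^ V.card else 0) := by
  have hy0 : 0 ≤ 1 - y := by linarith
  have hc : 0 ≤ y + (1 - y) * (M / P) := by positivity
  induction r generalizing V with
  | zero => simp [iterAvg]
  | succ r ih =>
    unfold iterAvg
    have hpos : (0 : ℝ) < P.choose k := by exact_mod_cast Nat.choose_pos hk
    have h1 : ringAvg k (iterAvg k r fun U => if (U.card : ℝ) ≤ M then y ^ U.card else 0) V ≤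
        (y + (1 - y) * (M / P)) ^ (k * r) *
          ringAvg k (fun U => if (U.card : ℝ) ≤ M then y ^ U.card else 0) V := by
      unfold ringAvg
      rw [← mul_div_assoc, Finset.mul_sum]
      gcongr with B hB
      exact ih _
    refine h1.trans ?_
    rw [Nat.mul_succ, pow_add, mul_assoc]
    gcongr
    split_ifs with hV
    · have h2 : ringAvg k (fun U : Finset (Fin P) => if (U.card : ℝ) ≤ M then y ^ U.card else 0) V
          ≤ ringAvg k (fun U => y ^ U.card) V := by
        unfold ringAvg
        gcongr with B hB
        dsimp only
        split_ifs
        · exact le_rfl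
        · positivity
      refine h2.trans ((ringAvg_pow_card_le hP hk hy hy1 V).trans ?_)
      rw [mul_comm]
      gcongr
    · unfold ringAvg
      rw [Finset.sum_eq_zero, zero_div, mul_zero]
      intro B _
      dsimp only
      rw [if_neg]
      intro h
      refine hV (le_trans ?_ h)
      exact_mod_cast Finset.card_le_card Finset.subset_union_left

/-- For an antitone function, larger rings give smaller averages. -/
theorem ringAvg_le_of_le {P k K : ℕ} (hkK : k ≤ K) (hK : K ≤ P) {F : Finset (Fin P) → ℝ}
    (hF : Antitone F) (V : Finset (Fin P)) : ringAvg K F V ≤ ringAvg k F V := by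
  have hp1 : (0 : ℝ) < P.choose k := by exact_mod_cast Nat.choose_pos (hkK.trans hK)
  have hp2 : (0 : ℝ) < P.choose K := by exact_mod_cast Nat.choose_pos hK
  have hp3 : (0 : ℝ) < K.choose k := by exact_mod_cast Nat.choose_pos hkK
  -- A uniform k-subset of a uniform K-set is a uniform k-set: double count the pairs B ⊆ A.
  have h1 : (∑ A ∈ Finset.powersetCard K Finset.univ, F (V ∪ A)) * K.choose k ≤
      ∑ A ∈ Finset.powersetCard K Finset.univ, ∑ B ∈ Finset.powersetCard k A, F (V ∪ B) := by
    rw [Finset.sum_mul]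
    refine Finset.sum_le_sum fun A hA => ?_
    rw [Finset.mem_powersetCard] at hA
    rw [mul_comm, ← nsmul_eq_mul, ← hA.2, ← Finset.card_powersetCard k A]
    refine Finset.card_nsmul_le_sum _ _ _ fun B hB => hF ?_
    rw [Finset.mem_powersetCard] at hB
    exact Finset.union_subset_union_right hB.1
  have h2 : ∑ A ∈ Finset.powersetCard K Finset.univ, ∑ B ∈ Finset.powersetCard k A, F (V ∪ B) =
      ∑ B ∈ Finset.powersetCard k Finset.univ,
        ∑ A ∈ (Finset.powersetCard K Finset.univ).filter (B ⊆ ·), F (V ∪ B) := by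
    refine Finset.sum_comm' fun A B => ?_
    simp only [Finset.mem_powersetCard, Finset.mem_filter, Finset.subset_univ, true_and]
    tauto
  have h3 : ∑ B ∈ Finset.powersetCard k Finset.univ,
        ∑ A ∈ (Finset.powersetCard K Finset.univ).filter (B ⊆ ·), F (V ∪ B) =
      (P - k).choose (K - k) * ∑ B ∈ Finset.powersetCard k Finset.univ, F (V ∪ B) := by
    rw [Finset.mul_sum]
    refine Finset.sum_congr rfl fun B hB => ?_
    rw [Finset.mem_powersetCard] at hB
    rw [Finset.sum_const, Finset.card_filter_powersetCard_subset _ _ _ hB.1 (by omega),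
      nsmul_eq_mul, hB.2]
    simp
  have e1 : (P.choose K : ℝ) * K.choose k = P.choose k * (P - k).choose (K - k) := by
    exact_mod_cast Nat.choose_mul (n := P) hkK
  rw [h2, h3] at h1
  unfold ringAvg
  rw [div_le_div_iff₀ hp2 hp1]
  have h4 := mul_le_mul_of_nonneg_right h1 hp1.le
  refine le_of_mul_le_mul_right ?_ hp3
  calc _ = (∑ A ∈ Finset.powersetCard K Finset.univ, F (V ∪ A)) * K.choose k * P.choose k := by
        ring
    _ ≤ _ := h4
    _ = (∑ B ∈ Finset.powersetCard k Finset.univ, F (V ∪ B)) *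
      (P.choose k * (P - k).choose (K - k)) := by ring
    _ = _ := by rw [← e1]; ring

/-! ### Sums over the law of the nodes -/

/-- The probability that the ring of a random node misses a given set of `u` keys. -/
noncomputable def avoidProb {m : ℕ} (a : Fin m → ℝ) (K : Fin m → ℕ) (P u : ℕ) : ℝ :=
  ∑ j, a j * missProb P (K j) u

section

variable {n m : ℕ} {a : Fin m → ℝ} {K : Fin m → ℕ} {P : ℕ}

theorem nodeWeight_nonneg (ha : ∀ i, 0 < a i) (x : Fin m × Finset (Fin P)) :
    0 ≤ nodeWeight a K P x := by
  unfold nodeWeight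
  have := ha x.1
  split_ifs <;> positivity

theorem weight_nonneg (ha : ∀ i, 0 < a i) (ω : Outcome n m P) : 0 ≤ weight n a K P ω :=
  Finset.prod_nonneg fun _ _ => nodeWeight_nonneg ha _

theorem sum_nodeWeight_mul (F : Fin m → Finset (Fin P) → ℝ) :
    ∑ x : Fin m × Finset (Fin P), nodeWeight a K P x * F x.1 x.2 =
      ∑ i, a i * ((∑ B ∈ Finset.powersetCard (K i) Finset.univ, F i B) / P.choose (K i)) := by
  rw [Fintype.sum_prod_type]
  refine Finset.sum_congr rfl fun i _ => ?_
  simp only [nodeWeight, ite_mul, zero_mul]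
  rw [← Finset.sum_filter, Finset.univ_filter_card_eq, ← Finset.mul_sum]
  ring

theorem avoidProb_nonneg (ha : ∀ i, 0 < a i) (u : ℕ) : 0 ≤ avoidProb a K P u :=
  Finset.sum_nonneg fun j _ => mul_nonneg (ha j).le (missProb_nonneg _ _ _)

theorem avoidProb_antitone (ha : ∀ i, 0 < a i) : Antitone (avoidProb a K P) := fun _ _ h =>
  Finset.sum_le_sum fun j _ => mul_le_mul_of_nonneg_left (missProb_antitone _ _ h) (ha j).le

theorem sum_nodeWeight_disjoint (U : Finset (Fin P)) :
    ∑ x, nodeWeight a K P x * (if Disjoint U x.2 then 1 else 0) = avoidProb a K P U.card := by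
  rw [sum_nodeWeight_mul fun _ B => if Disjoint U B then (1 : ℝ) else 0]
  refine Finset.sum_congr rfl fun i _ => ?_
  rw [missProb, ← Finset.sum_filter, Finset.sum_const, nsmul_eq_mul, mul_one]
  congr 3
  rw [show (Finset.powersetCard (K i) Finset.univ).filter (fun B => Disjoint U B) =
    Finset.powersetCard (K i) Uᶜ by
      ext B
      simp only [Finset.mem_filter, Finset.mem_powersetCard, Finset.subset_univ, true_and,
        Finset.subset_compl_iff_disjoint_left]
      tauto]
  rw [Finset.card_powersetCard, Finset.card_compl, Fintype.card_fin]

/-! ### Separated sets and the union bound over cuts -/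

/-- The set of keys held by the nodes of `S`. -/
def keys (S : Finset (Fin n)) (ω : Outcome n m P) : Finset (Fin P) := S.biUnion fun v => (ω v).2

/-- The event that no node outside `S` shares a key with a node of `S`. -/
def Separated (S : Finset (Fin n)) : Set (Outcome n m P) :=
  {ω | ∀ v ∉ S, Disjoint (keys S ω) (ω v).2}

-- Condition on the nodes of S: the n - |S| others are independent, and each must miss the same
-- union of rings.
open Classical in
theorem sum_weight_separated (S : Finset (Fin n)) (g : (S → Fin m × Finset (Fin P)) → ℝ) :
    ∑ ω : Outcome n m P,
      (if ω ∈ Separated S then weight n a K P ω * g (fun v => ω v) else 0) =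
    ∑ σ : S → Fin m × Finset (Fin P), (∏ v, nodeWeight a K P (σ v)) * g σ *
      avoidProb a K P (Finset.univ.biUnion fun v => (σ v).2).card ^ (n - S.card) := by
  let e := Equiv.piEquivPiSubtypeProd (fun v => v ∈ S) (fun _ : Fin n => Fin m × Finset (Fin P))
  rw [← e.symm.sum_comp, Fintype.sum_prod_type]
  refine Finset.sum_congr rfl fun σ _ => ?_
  have hS : ∀ τ, (fun v : S => e.symm (σ, τ) v) = σ := by
    intro τ
    ext1 v
    have : v.1 ∈ S := v.2
    simp [e, Equiv.piEquivPiSubtypeProd]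
  have hSc : ∀ τ (v : {v // v ∉ S}), e.symm (σ, τ) v = τ v := by
    intro τ v
    have : v.1 ∉ S := v.2
    simp [e, Equiv.piEquivPiSubtypeProd, this]
  have hkeys : ∀ τ, keys S (e.symm (σ, τ)) = Finset.univ.biUnion fun v => (σ v).2 := by
    intro τ
    ext x
    simp only [keys, Finset.mem_biUnion, Finset.mem_univ, true_and]
    constructor
    · rintro ⟨v, hv, hx⟩
      refine ⟨⟨v, hv⟩, ?_⟩
      rwa [← congrFun (hS τ) ⟨v, hv⟩]
    · rintro ⟨v, hx⟩
      refine ⟨v, v.2, ?_⟩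
      rwa [← congrFun (hS τ) v] at hx
  have hterm : ∀ τ, (if e.symm (σ, τ) ∈ Separated S then
        weight n a K P (e.symm (σ, τ)) * g (fun v => e.symm (σ, τ) v) else 0) =
      (∏ v, nodeWeight a K P (σ v)) * g σ * ∏ v, (nodeWeight a K P (τ v) *
        (if Disjoint (Finset.univ.biUnion fun v => (σ v).2) (τ v).2 then 1 else 0)) := by
    intro τ
    have hw : weight n a K P (e.symm (σ, τ)) =
        (∏ v, nodeWeight a K P (σ v)) * ∏ v, nodeWeight a K P (τ v) := by
      unfold weight
      rw [← Fintype.prod_subtype_mul_prod_subtype (fun v => v ∈ S)]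
      congr 1
      · exact Finset.prod_congr (by ext; simp) fun v _ => by rw [← congrFun (hS τ) v]
      · exact Finset.prod_congr rfl fun v _ => by rw [hSc]
    have hmem : e.symm (σ, τ) ∈ Separated S ↔
        ∀ v, Disjoint (Finset.univ.biUnion fun v => (σ v).2) (τ v).2 := by
      simp only [Separated, Set.mem_ofPred_eq, hkeys]
      constructor
      · intro h v
        rw [← hSc τ v]
        exact h v v.2
      · intro h v hv
        have := hSc τ ⟨v, hv⟩
        simp only at this
        rw [this]
        exact h _
    rw [hw, hS, Finset.prod_mul_distrib]
    by_cases h : ∀ v, Disjoint (Finset.univ.biUnion fun v => (σ v).2) (τ v).2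
    · rw [if_pos (hmem.2 h), Finset.prod_eq_one (fun v _ => if_pos (h v))]
      ring
    · rw [if_neg (fun h' => h (hmem.1 h'))]
      push Not at h
      obtain ⟨v, hv⟩ := h
      rw [Finset.prod_eq_zero (f := fun v => if Disjoint _ (τ v).2 then (1 : ℝ) else 0)
        (Finset.mem_univ v) (if_neg hv)]
      ring
  simp only [hterm]
  rw [← Finset.mul_sum, ← Fintype.prod_sum (fun (_ : {v // v ∉ S}) x => nodeWeight a K P x *
    (if Disjoint (Finset.univ.biUnion fun v => (σ v).2) x.2 then 1 else 0))]
  simp only [sum_nodeWeight_disjoint, Finset.prod_const]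
  congr 2
  rw [Finset.card_univ, Fintype.card_subtype_compl, Fintype.card_fin, Fintype.card_coe]

/-- The nodes are revealed one at a time, each ring being shrunk to size k whatever its group. V
carries the keys already revealed, and the remaining average is antitone in V, so the shrinking can
be repeated. -/
theorem sum_prod_nodeWeight_le_iterAvg (ha : ∀ i, 0 < a i) (ha1 : ∑ i, a i = 1) {k : ℕ}
    (hk : ∀ i, k ≤ K i) (hK : ∀ i, K i ≤ P) {F : Finset (Fin P) → ℝ} (hF : Antitone F) (r : ℕ)
    (V : Finset (Fin P)) :
    ∑ σ : Fin r → Fin m × Finset (Fin P), (∏ v, nodeWeight a K P (σ v)) *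
      F (V ∪ Finset.univ.biUnion fun v => (σ v).2) ≤ iterAvg k r F V := by
  induction r generalizing V with
  | zero => simp [iterAvg]
  | succ r ih =>
    have hanti : ∀ r, Antitone fun V : Finset (Fin P) =>
        ∑ σ : Fin r → Fin m × Finset (Fin P), (∏ v, nodeWeight a K P (σ v)) *
          F (V ∪ Finset.univ.biUnion fun v => (σ v).2) := by
      intro r V W h
      refine Finset.sum_le_sum fun σ _ => ?_
      exact mul_le_mul_of_nonneg_left (hF (Finset.union_subset_union_left h))
        (Finset.prod_nonneg fun _ _ => nodeWeight_nonneg ha _)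
    have h1 : ∑ σ : Fin (r + 1) → Fin m × Finset (Fin P), (∏ v, nodeWeight a K P (σ v)) *
          F (V ∪ Finset.univ.biUnion fun v => (σ v).2) =
        ∑ x : Fin m × Finset (Fin P), nodeWeight a K P x *
          ∑ σ : Fin r → Fin m × Finset (Fin P), (∏ v, nodeWeight a K P (σ v)) *
          F ((V ∪ x.2) ∪ Finset.univ.biUnion fun v => (σ v).2) := by
      rw [← (Fin.consEquiv fun _ => Fin m × Finset (Fin P)).sum_comp, Fintype.sum_prod_type]
      refine Finset.sum_congr rfl fun x _ => ?_
      rw [Finset.mul_sum]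
      refine Finset.sum_congr rfl fun σ _ => ?_
      rw [Fin.prod_univ_succ, mul_assoc]
      congr 2
      congr 1
      rw [Finset.union_assoc]
      congr 1
      ext y
      simp [Fin.consEquiv, Fin.exists_fin_succ]
    rw [h1, sum_nodeWeight_mul fun _ B => ∑ σ : Fin r → Fin m × Finset (Fin P),
      (∏ v, nodeWeight a K P (σ v)) * F ((V ∪ B) ∪ Finset.univ.biUnion fun v => (σ v).2)]
    have h2 : ∀ i, (∑ B ∈ Finset.powersetCard (K i) Finset.univ,
        ∑ σ : Fin r → Fin m × Finset (Fin P), (∏ v, nodeWeight a K P (σ v)) *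
          F ((V ∪ B) ∪ Finset.univ.biUnion fun v => (σ v).2)) / P.choose (K i) ≤
        iterAvg k (r + 1) F V := by
      intro i
      refine (ringAvg_le_of_le (hk i) (hK i) (hanti r) V).trans ?_
      unfold iterAvg ringAvg
      gcongr with B hB
      exact ih _
    calc _ ≤ ∑ i, a i * iterAvg k (r + 1) F V :=
          Finset.sum_le_sum fun i _ => mul_le_mul_of_nonneg_left (h2 i) (ha i).le
      _ = _ := by rw [← Finset.sum_mul, ha1, one_mul]

theorem prob_separated_le (ha : ∀ i, 0 < a i) (ha1 : ∑ i, a i = 1) {k : ℕ}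
    (hk : ∀ i, k ≤ K i) (hK : ∀ i, K i ≤ P) (S : Finset (Fin n)) :
    prob n a K P (Separated S) ≤
      iterAvg k S.card (fun U : Finset (Fin P) => avoidProb a K P U.card ^ (n - S.card)) ∅ := by
  classical
  have h := sum_weight_separated (a := a) (K := K) (P := P) S (fun _ => 1)
  simp only [mul_one] at h
  unfold prob
  have hF : Antitone fun U : Finset (Fin P) => avoidProb a K P U.card ^ (n - S.card) :=
    fun U V h => pow_le_pow_left₀ (avoidProb_nonneg ha _)
      (avoidProb_antitone ha (Finset.card_le_card h)) _
  refine le_trans (le_of_eq ?_) (sum_prod_nodeWeight_le_iterAvg ha ha1 hk hK hF S.card ∅)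
  rw [show (∑ ω : Outcome n m P, if ω ∈ Separated S then weight n a K P ω else 0) = _ by
    convert h]
  rw [← (Equiv.arrowCongr S.equivFin (Equiv.refl (Fin m × Finset (Fin P)))).sum_comp]
  refine Finset.sum_congr rfl fun σ _ => ?_
  congr 1
  · rw [← S.equivFin.prod_comp]
    simp
  · congr 3
    ext x
    simp only [Finset.mem_biUnion, Finset.mem_univ, true_and, Equiv.arrowCongr_apply,
      Equiv.coe_refl, Function.comp_apply, id_eq, Finset.empty_union]
    constructor
    · rintro ⟨v, hv⟩
      exact ⟨S.equivFin v, by simpa using hv⟩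
    · rintro ⟨i, hi⟩
      exact ⟨S.equivFin.symm i, hi⟩

theorem prob_nonneg (ha : ∀ i, 0 < a i) (E : Set (Outcome n m P)) : 0 ≤ prob n a K P E :=
  Finset.sum_nonneg fun ω _ => by
    split_ifs
    · exact weight_nonneg ha ω
    · exact le_rfl

theorem prob_le_one (ha : ∀ i, 0 < a i) (ha1 : ∑ i, a i = 1) (hK : ∀ i, K i ≤ P)
    (E : Set (Outcome n m P)) : prob n a K P E ≤ 1 := by
  rw [← prob_univ n a ha1 K P hK]
  refine Finset.sum_le_sum fun ω _ => ?_
  have := weight_nonneg (K := K) ha ω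
  simp only [Set.mem_univ, if_true]
  split_ifs
  · exact le_rfl
  · exact this

/-- Take a connected component or its complement, whichever is smaller; separation is symmetric. -/
theorem exists_separated_of_not_connected (hn : 0 < n) {ω : Outcome n m P}
    (h : ¬ (graph ω).Connected) :
    ∃ S : Finset (Fin n), 1 ≤ S.card ∧ S.card ≤ n / 2 ∧ ω ∈ Separated S := by
  classical
  have : Nonempty (Fin n) := ⟨⟨0, hn⟩⟩
  have hpre : ¬ (graph ω).Preconnected := fun h' => h ⟨h'⟩
  simp only [SimpleGraph.Preconnected, not_forall] at hpre
  obtain ⟨u, v, huv⟩ := hpre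
  let S : Finset (Fin n) := Finset.univ.filter fun w => (graph ω).Reachable u w
  have hsep : ∀ x ∈ S, ∀ y ∉ S, Disjoint (ω x).2 (ω y).2 := by
    intro x hx y hy
    simp only [S, Finset.mem_filter, Finset.mem_univ, true_and] at hx hy
    by_contra hd
    have hadj : (graph ω).Adj x y := by
      refine ⟨?_, ?_⟩
      · rintro rfl
        exact hy hx
      · rwa [Finset.not_disjoint_iff_nonempty_inter] at hd
    exact hy (hx.trans hadj.reachable)
  have h1 : ω ∈ Separated S := by
    intro y hy
    rw [keys, Finset.disjoint_biUnion_left]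
    exact fun x hx => hsep x hx y hy
  have h2 : ω ∈ Separated Sᶜ := by
    intro y hy
    rw [keys, Finset.disjoint_biUnion_left]
    rw [Finset.mem_compl, not_not] at hy
    exact fun x hx => (hsep y hy x (Finset.mem_compl.1 hx)).symm
  have hu : u ∈ S := by simp [S]
  have hv : v ∈ Sᶜ := by simpa [S] using huv
  have hc := Finset.card_add_card_compl S
  rw [Fintype.card_fin] at hc
  have c1 := Finset.card_pos.2 ⟨u, hu⟩
  have c2 := Finset.card_pos.2 ⟨v, hv⟩
  by_cases hle : S.card ≤ n / 2
  · exact ⟨S, c1, hle, h1⟩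
  · exact ⟨Sᶜ, c2, by omega, h2⟩

theorem one_sub_connProb_le (hn : 0 < n) (ha : ∀ i, 0 < a i) (ha1 : ∑ i, a i = 1) {k : ℕ}
    (hk : ∀ i, k ≤ K i) (hK : ∀ i, K i ≤ P) :
    1 - connProb n a K P ≤ ∑ r ∈ Finset.Icc 1 (n / 2), (n.choose r : ℝ) *
      iterAvg k r (fun U : Finset (Fin P) => avoidProb a K P U.card ^ (n - r)) ∅ := by
  classical
  have h1 : 1 - connProb n a K P ≤
      ∑ S ∈ (Finset.univ : Finset (Finset (Fin n))).filter
        (fun S => S.card ∈ Finset.Icc 1 (n / 2)), prob n a K P (Separated S) := by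
    rw [← prob_univ n a ha1 K P hK]
    unfold connProb prob
    rw [← Finset.sum_sub_distrib, Finset.sum_comm]
    refine Finset.sum_le_sum fun ω _ => ?_
    have hw := weight_nonneg (K := K) ha ω
    have hnn : ∀ S : Finset (Fin n), 0 ≤ if ω ∈ Separated S then weight n a K P ω else 0 := by
      intro S
      split_ifs
      · exact hw
      · exact le_rfl
    simp only [Set.mem_univ, if_true, Set.mem_ofPred_eq]
    split_ifs with hconn
    · rw [sub_self]
      exact Finset.sum_nonneg fun S _ => hnn S
    · obtain ⟨S, hS1, hS2, hS⟩ := exists_separated_of_not_connected hn hconn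
      refine le_trans ?_ (Finset.single_le_sum (fun S _ => hnn S)
        (Finset.mem_filter.2 ⟨Finset.mem_univ S, Finset.mem_Icc.2 ⟨hS1, hS2⟩⟩))
      rw [if_pos hS, sub_zero]
  refine h1.trans ?_
  rw [← Finset.sum_fiberwise_of_maps_to (g := Finset.card) (t := Finset.Icc 1 (n / 2))
    fun S hS => (Finset.mem_filter.1 hS).2]
  refine Finset.sum_le_sum fun r hr => ?_
  have hcard : (((Finset.univ : Finset (Finset (Fin n))).filter
      (fun S => S.card ∈ Finset.Icc 1 (n / 2))).filter (fun S => S.card = r)).card =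
      n.choose r := by
    rw [Finset.filter_filter, Finset.filter_congr (q := fun S => S.card = r),
      Finset.univ_filter_card_eq, Finset.card_powersetCard, Finset.card_univ, Fintype.card_fin]
    intro S _
    constructor
    · exact fun h => h.2
    · rintro rfl
      exact ⟨hr, rfl⟩
  rw [← hcard, ← nsmul_eq_mul]
  refine Finset.sum_le_card_nsmul _ _ _ fun S hS => ?_
  obtain rfl := (Finset.mem_filter.1 hS).2
  exact prob_separated_le ha ha1 hk hK S

end

/-! ### Bounds on the expected number of separated sets -/

theorem choose_le_exp_mul_div_pow {n r : ℕ} (hr : 1 ≤ r) :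
    (n.choose r : ℝ) ≤ (Real.exp 1 * n / r) ^ r := by
  have hr' : (0 : ℝ) < r := by exact_mod_cast hr
  have h1 : (n.choose r : ℝ) ≤ n ^ r / r.factorial := Nat.choose_le_pow_div r n
  have h2 := Real.pow_div_factorial_le_exp (r : ℝ) hr'.le r
  have hf : (0 : ℝ) < r.factorial := by exact_mod_cast Nat.factorial_pos r
  refine h1.trans ?_
  rw [div_pow, mul_pow, ← Real.exp_nat_mul, mul_one, div_le_div_iff₀ hf (by positivity)]
  rw [div_le_iff₀ hf] at h2
  calc (n : ℝ) ^ r * r ^ r ≤ n ^ r * (Real.exp r * r.factorial) := by gcongr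
    _ = _ := by ring

/-- Separates the two ways a key may cost little: overlap (2z) or avoidance, at the price of half
the exponent (√y). -/
theorem add_mul_le_or {y z : ℝ} (hy : 0 ≤ y) (hy1 : y ≤ 1) (hz : 0 ≤ z) (hz4 : z ≤ 1 / 4) :
    y + (1 - y) * z ≤ 2 * z ∨ y + (1 - y) * z ≤ √y := by
  rcases le_total y z with h | h
  · left; nlinarith
  · right
    obtain ⟨s, hs, rfl⟩ : ∃ s : ℝ, 0 ≤ s ∧ s ^ 2 = y := ⟨√y, Real.sqrt_nonneg y, Real.sq_sqrt hy⟩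
    rw [Real.sqrt_sq hs]
    have hs1 : s ≤ 1 := by nlinarith
    -- With y = s², the bound by s is this inequality multiplied by 1 - s.
    have key : (1 + s) * z ≤ s := by
      rcases le_total s (1 / 2) with h2 | h2
      · nlinarith [mul_le_mul_of_nonneg_left h (show 0 ≤ 1 + s by linarith)]
      · nlinarith
    nlinarith [mul_le_mul_of_nonneg_left key (show 0 ≤ 1 - s by linarith)]

section

variable {n m : ℕ} {a : Fin m → ℝ} {K : Fin m → ℕ} {P k r : ℕ}

/-- The cutoff M = r k is free, since r rings never cover more keys. -/
theorem iterAvg_avoidProb_le (hP : 0 < P) (hk : k ≤ P) {θ : ℝ} (hθ : 0 ≤ θ)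
    (hq : ∀ u ≤ r * k, avoidProb a K P u ^ (n - r) ≤ Real.exp (-(θ * u))) :
    iterAvg k r (fun U : Finset (Fin P) => avoidProb a K P U.card ^ (n - r)) ∅ ≤
      ((Real.exp (-θ) + (1 - Real.exp (-θ)) * (r * k / P)) ^ k) ^ r := by
  classical
  have hy := Real.exp_pos (-θ)
  have hy1 : Real.exp (-θ) ≤ 1 := Real.exp_le_one_iff.2 (by linarith)
  have h1 := iterAvg_cutoff_le hP hk hy hy1 (M := r * k) (by positivity) r ∅
  refine (iterAvg_le_of_card fun U hU => ?_).trans (h1.trans (le_of_eq ?_))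
  · rw [Finset.card_empty, zero_add] at hU
    rw [if_pos (by exact_mod_cast hU), ← Real.exp_nat_mul]
    convert hq _ hU using 2
    ring
  · rw [if_pos (by simp; positivity), pow_mul]
    simp

/-- For ranges with room to lose half of the exponent θ k: `h1` handles dominant overlap, `h2`
dominant avoidance. -/
theorem choose_mul_iterAvg_le_of_crude (hP : 0 < P) (hk : k ≤ P) (hr : 1 ≤ r)
    {ε θ : ℝ} (hθ : 0 ≤ θ)
    (hq : ∀ u ≤ r * k, avoidProb a K P u ^ (n - r) ≤ Real.exp (-(θ * u)))
    (hz : (r * k / P : ℝ) ≤ 1 / 4)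
    (h1 : Real.exp 1 * n / r * (2 * (r * k / P)) ^ k ≤ ε)
    (h2 : Real.exp 1 * n / r * Real.exp (-(θ * k / 2)) ≤ ε) :
    (n.choose r : ℝ) *
      iterAvg k r (fun U : Finset (Fin P) => avoidProb a K P U.card ^ (n - r)) ∅ ≤ ε ^ r := by
  have hy := Real.exp_pos (-θ)
  have hy1 : Real.exp (-θ) ≤ 1 := Real.exp_le_one_iff.2 (by linarith)
  have hz0 : (0 : ℝ) ≤ r * k / P := by positivity
  set y := Real.exp (-θ) with hydef
  set z : ℝ := r * k / P with hzdef
  have hbase : 0 ≤ y + (1 - y) * z := by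
    have : 0 ≤ 1 - y := by linarith
    positivity
  have hmain : Real.exp 1 * n / r * (y + (1 - y) * z) ^ k ≤ ε := by
    rcases add_mul_le_or hy.le hy1 hz0 hz with h | h
    · exact le_trans (by gcongr) h1
    · refine le_trans ?_ h2
      have : Real.exp (-(θ * k / 2)) = √y ^ k := by
        rw [hydef, Real.sqrt_eq_rpow, ← Real.exp_mul, ← Real.exp_nat_mul]
        congr 1; ring
      rw [this]
      gcongr
  calc _ ≤ (n.choose r : ℝ) * ((y + (1 - y) * z) ^ k) ^ r :=
        mul_le_mul_of_nonneg_left (iterAvg_avoidProb_le hP hk hθ hq) (by positivity)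
    _ ≤ (Real.exp 1 * n / r) ^ r * ((y + (1 - y) * z) ^ k) ^ r := by
        gcongr
        exact choose_le_exp_mul_div_pow hr
    _ = (Real.exp 1 * n / r * (y + (1 - y) * z) ^ k) ^ r := by rw [mul_pow]
    _ ≤ ε ^ r := by gcongr

/-- Keeps the whole exponent: with z = rk/P, y + (1-y)z ≤ y(1 + z exp θ) ≤ exp(-θ + z exp θ), so
overlap becomes an additive correction. -/
theorem choose_mul_iterAvg_le_of_fine (hP : 0 < P) (hk : k ≤ P)
    {ε θ : ℝ} (hθ : 0 ≤ θ)
    (hq : ∀ u ≤ r * k, avoidProb a K P u ^ (n - r) ≤ Real.exp (-(θ * u)))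
    (h : n * Real.exp (-(θ * k) + k * (r * k / P) * Real.exp θ) ≤ ε) :
    (n.choose r : ℝ) *
      iterAvg k r (fun U : Finset (Fin P) => avoidProb a K P U.card ^ (n - r)) ∅ ≤ ε ^ r := by
  have hy := Real.exp_pos (-θ)
  have hy1 : Real.exp (-θ) ≤ 1 := Real.exp_le_one_iff.2 (by linarith)
  have hz0 : (0 : ℝ) ≤ r * k / P := by positivity
  have hbase : 0 ≤ Real.exp (-θ) + (1 - Real.exp (-θ)) * (r * k / P) := by
    have : 0 ≤ 1 - Real.exp (-θ) := by linarith
    positivity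
  have h1 : Real.exp (-θ) + (1 - Real.exp (-θ)) * (r * k / P) ≤
      Real.exp (-θ + (r * k / P) * Real.exp θ) := by
    rw [Real.exp_add]
    have e1 : Real.exp (-θ) * Real.exp θ = 1 := by rw [← Real.exp_add]; simp
    have e2 := Real.add_one_le_exp ((r * k / P : ℝ) * Real.exp θ)
    have e3 := mul_le_mul_of_nonneg_left e2 hy.le
    nlinarith
  have hmain : (n : ℝ) * (Real.exp (-θ) + (1 - Real.exp (-θ)) * (r * k / P)) ^ k ≤ ε := by
    refine le_trans ?_ h
    gcongr
    calc _ ≤ Real.exp (-θ + (r * k / P) * Real.exp θ) ^ k := by gcongr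
      _ = _ := by rw [← Real.exp_nat_mul]; congr 1; ring
  have hch : (n.choose r : ℝ) ≤ n ^ r := by exact_mod_cast Nat.choose_le_pow n r
  calc _ ≤ (n.choose r : ℝ) *
        ((Real.exp (-θ) + (1 - Real.exp (-θ)) * (r * k / P)) ^ k) ^ r :=
        mul_le_mul_of_nonneg_left (iterAvg_avoidProb_le hP hk hθ hq) (by positivity)
    _ ≤ (n : ℝ) ^ r * ((Real.exp (-θ) + (1 - Real.exp (-θ)) * (r * k / P)) ^ k) ^ r := by gcongr
    _ = (n * (Real.exp (-θ) + (1 - Real.exp (-θ)) * (r * k / P)) ^ k) ^ r := by rw [mul_pow]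
    _ ≤ ε ^ r := by gcongr

/-! ### Exponential bounds on the probability of avoiding a set of keys -/

theorem avoidProb_le_exp (hP : 0 < P) (ha : ∀ i, 0 < a i) (ha1 : ∑ i, a i = 1)
    (hk : ∀ i, k ≤ K i) (hK : ∀ i, K i ≤ P) (u : ℕ) :
    avoidProb a K P u ≤ Real.exp (-(k / P * u)) := by
  have h : ∀ j, missProb P (K j) u ≤ Real.exp (-(k / P * u)) := by
    intro j
    refine (missProb_le_exp hP (hK j) u).trans (Real.exp_le_exp.2 ?_)
    have : (k : ℝ) ≤ K j := by exact_mod_cast hk j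
    rw [neg_le_neg_iff, mul_comm, ← mul_div_assoc]
    gcongr
  calc _ ≤ ∑ j, a j * Real.exp (-(k / P * u)) :=
        Finset.sum_le_sum fun j _ => mul_le_mul_of_nonneg_left (h j) (ha j).le
    _ = _ := by rw [← Finset.sum_mul, ha1, one_mul]

theorem avoidProb_pow_le_exp (hP : 0 < P) (ha : ∀ i, 0 < a i) (ha1 : ∑ i, a i = 1)
    (hk : ∀ i, k ≤ K i) (hK : ∀ i, K i ≤ P) (N u : ℕ) :
    avoidProb a K P u ^ N ≤ Real.exp (-(N * (k / P) * u)) := by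
  calc _ ≤ Real.exp (-(k / P * u)) ^ N :=
        pow_le_pow_left₀ (avoidProb_nonneg ha u) (avoidProb_le_exp hP ha ha1 hk hK u) N
    _ = _ := by rw [← Real.exp_nat_mul]; congr 1; ring

/-- A lower bound on the probability that a random ring meets the union of `r` disjoint rings of
size `k`. -/
noncomputable def hitBound (a : Fin m → ℝ) (K : Fin m → ℕ) (P k : ℕ) (r : ℕ) : ℝ :=
  ∑ j, a j * (r * (1 - missProb P (K j) k) / (1 + r * (1 - missProb P (K j) k)))

/-- For each group, with x the chance of hitting k keys, (1-x)^r ≤ exp(-rx) ≤ 1/(1+rx). -/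
theorem avoidProb_mul_le (ha : ∀ i, 0 < a i) (ha1 : ∑ i, a i = 1) (hK : ∀ i, K i ≤ P) (r : ℕ) :
    avoidProb a K P (r * k) ≤ 1 - hitBound a K P k r := by
  rw [← ha1, hitBound, ← Finset.sum_sub_distrib]
  refine Finset.sum_le_sum fun j _ => ?_
  have h0 := missProb_le_one P (K j) k
  have h00 := missProb_nonneg P (K j) k
  set q := missProb P (K j) k
  have hx : 0 ≤ (r : ℝ) * (1 - q) := mul_nonneg (by positivity) (by linarith)
  have h1 : missProb P (K j) (r * k) ≤ 1 / (1 + r * (1 - q)) := by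
    calc _ ≤ q ^ r := missProb_mul_le (hK j) k r
      _ ≤ Real.exp (-(1 - q)) ^ r := by
          gcongr
          linarith [Real.add_one_le_exp (-(1 - q))]
      _ = (Real.exp (r * (1 - q)))⁻¹ := by
          rw [← Real.exp_nat_mul, ← Real.exp_neg]; congr 1; ring
      _ ≤ _ := by
          rw [one_div]
          gcongr
          linarith [Real.add_one_le_exp ((r : ℝ) * (1 - q))]
  have h2 : 1 / (1 + r * (1 - q)) = 1 - r * (1 - q) / (1 + r * (1 - q)) := by
    field_simp
    ring
  calc _ ≤ a j * (1 / (1 + r * (1 - q))) := mul_le_mul_of_nonneg_left h1 (ha j).le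
    _ = _ := by rw [h2]; ring

theorem hitBound_nonneg (ha : ∀ i, 0 < a i) : 0 ≤ hitBound a K P k r :=
  Finset.sum_nonneg fun j _ => by
    have h0 : 0 ≤ 1 - missProb P (K j) k := by linarith [missProb_le_one P (K j) k]
    have := ha j
    positivity

/-- The hitting probability 1 - q(u) is concave in u and vanishes at 0, so up to u = r k it lies
above its chord, whose slope is at least `hitBound` divided by r k. -/
theorem avoidProb_pow_le_exp_hitBound (ha : ∀ i, 0 < a i) (ha1 : ∑ i, a i = 1)
    (hK1 : ∀ i, 1 ≤ K i) (hK : ∀ i, K i ≤ P) (hk : 1 ≤ k) (hr : 1 ≤ r) (N : ℕ) {u : ℕ}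
    (hu : u ≤ r * k) :
    avoidProb a K P u ^ N ≤ Real.exp (-(N * hitBound a K P k r / (r * k) * u)) := by
  have hrk : (0 : ℝ) < r * k := by positivity
  have h1 : (u : ℝ) * (1 - avoidProb a K P (r * k)) ≤ ((r * k : ℕ) : ℝ) * (1 - avoidProb a K P u) := by
    refine mul_le_mul_of_antitone_increments (g := fun u => 1 - avoidProb a K P u) ?_ ?_ hu
    · simp only [avoidProb, missProb_zero (hK _), mul_one, ha1, sub_self, le_refl]
    · intro v w hvw
      simp only [avoidProb, sub_sub_sub_cancel_left, ← Finset.sum_sub_distrib, ← mul_sub]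
      exact Finset.sum_le_sum fun j _ => mul_le_mul_of_nonneg_left
        (missProb_sub_succ_antitone (hK1 j) hvw) (ha j).le
  have h2 := avoidProb_mul_le (k := k) ha ha1 hK r
  have h3 : avoidProb a K P u ≤ Real.exp (-(hitBound a K P k r / (r * k) * u)) := by
    refine le_trans ?_ (Real.add_one_le_exp _)
    push_cast at h1
    have h4 : hitBound a K P k r / (r * k) * u ≤ 1 - avoidProb a K P u := by
      rw [div_mul_eq_mul_div, div_le_iff₀ hrk]
      have : (u : ℝ) * hitBound a K P k r ≤ u * (1 - avoidProb a K P (r * k)) := by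
        gcongr; linarith
      linarith
    linarith
  calc _ ≤ Real.exp (-(hitBound a K P k r / (r * k) * u)) ^ N :=
        pow_le_pow_left₀ (avoidProb_nonneg ha u) h3 N
    _ = _ := by rw [← Real.exp_nat_mul]; congr 1; ring

end

/-! ### Size of the hitting bound in terms of the edge probability -/

section

variable {n m : ℕ} {a : Fin m → ℝ} {K : Fin m → ℕ} {P k r : ℕ}

theorem sum_mul_one_sub_missProb (ha1 : ∑ i, a i = 1) :
    ∑ j, a j * (1 - missProb P (K j) k) = 1 - avoidProb a K P k := by
  simp only [mul_sub, mul_one, Finset.sum_sub_distrib, ha1, avoidProb]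

theorem mul_one_sub_missProb_le (ha : ∀ i, 0 < a i) (ha1 : ∑ i, a i = 1) (j : Fin m) :
    a j * (1 - missProb P (K j) k) ≤ 1 - avoidProb a K P k := by
  rw [← sum_mul_one_sub_missProb ha1]
  exact Finset.single_le_sum (f := fun j => a j * (1 - missProb P (K j) k))
    (fun j _ => mul_nonneg (ha j).le (by linarith [missProb_le_one P (K j) k]))
    (Finset.mem_univ j)

/-- No group can exceed the mean by more than a factor 1/b, because its own share a j of the mean is
at least b. -/
theorem sum_mul_sq_one_sub_missProb_le (ha : ∀ i, 0 < a i) (ha1 : ∑ i, a i = 1) {b : ℝ}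
    (hb : 0 < b) (hba : ∀ i, b ≤ a i) :
    ∑ j, a j * (1 - missProb P (K j) k) ^ 2 ≤ (1 - avoidProb a K P k) ^ 2 / b := by
  have h : ∀ j, a j * (1 - missProb P (K j) k) ^ 2 ≤
      a j * (1 - missProb P (K j) k) * ((1 - avoidProb a K P k) / b) := by
    intro j
    have h0 : 0 ≤ 1 - missProb P (K j) k := by linarith [missProb_le_one P (K j) k]
    rw [sq, ← mul_assoc]
    refine mul_le_mul_of_nonneg_left ?_ (mul_nonneg (ha j).le h0)
    rw [le_div_iff₀ hb]
    have := mul_one_sub_missProb_le (K := K) (P := P) (k := k) ha ha1 j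
    nlinarith [hba j]
  refine (Finset.sum_le_sum fun j _ => h j).trans (le_of_eq ?_)
  rw [← Finset.sum_mul, sum_mul_one_sub_missProb ha1]
  ring

theorem hitBound_le (ha : ∀ i, 0 < a i) (ha1 : ∑ i, a i = 1) :
    hitBound a K P k r ≤ r * (1 - avoidProb a K P k) := by
  rw [← sum_mul_one_sub_missProb ha1, Finset.mul_sum]
  refine Finset.sum_le_sum fun j _ => ?_
  have h0 : 0 ≤ 1 - missProb P (K j) k := by linarith [missProb_le_one P (K j) k]
  rw [mul_left_comm]
  refine mul_le_mul_of_nonneg_left (div_le_self (by positivity) ?_) (ha j).le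
  have : 0 ≤ (r : ℝ) * (1 - missProb P (K j) k) := by positivity
  linarith

/-- From x/(1+x) ≥ x - x². This second-order accuracy is what the sharp regime needs. -/
theorem le_hitBound (ha : ∀ i, 0 < a i) (ha1 : ∑ i, a i = 1) {b : ℝ}
    (hb : 0 < b) (hba : ∀ i, b ≤ a i) :
    r * (1 - avoidProb a K P k) - r ^ 2 * ((1 - avoidProb a K P k) ^ 2 / b) ≤
      hitBound a K P k r := by
  have h := mul_le_mul_of_nonneg_left
    (sum_mul_sq_one_sub_missProb_le (K := K) (P := P) (k := k) ha ha1 hb hba)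
    (show (0 : ℝ) ≤ r ^ 2 by positivity)
  have h2 : r * (1 - avoidProb a K P k) -
      r ^ 2 * ∑ j, a j * (1 - missProb P (K j) k) ^ 2 ≤ hitBound a K P k r := by
    rw [← sum_mul_one_sub_missProb ha1, Finset.mul_sum, Finset.mul_sum, ← Finset.sum_sub_distrib]
    refine Finset.sum_le_sum fun j _ => ?_
    have h0 : 0 ≤ 1 - missProb P (K j) k := by linarith [missProb_le_one P (K j) k]
    set y := 1 - missProb P (K j) k
    have hx : 0 ≤ (r : ℝ) * y := by positivity
    rw [show (r : ℝ) * (a j * y) - r ^ 2 * (a j * y ^ 2) = a j * (r * y - (r * y) ^ 2) by ring]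
    refine mul_le_mul_of_nonneg_left ?_ (ha j).le
    rw [le_div_iff₀ (by linarith)]
    nlinarith [mul_nonneg hx (mul_nonneg hx hx)]
  linarith

/-- Either every group has x ≤ 1, where x/(1+x) ≥ x/2, or a single group with x > 1 already
contributes b/2. -/
theorem half_min_le_hitBound (ha : ∀ i, 0 < a i) (ha1 : ∑ i, a i = 1) {b : ℝ}
    (hba : ∀ i, b ≤ a i) :
    min b (r * (1 - avoidProb a K P k)) / 2 ≤ hitBound a K P k r := by
  have h0 : ∀ j, 0 ≤ (r : ℝ) * (1 - missProb P (K j) k) := fun j =>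
    mul_nonneg (by positivity) (by linarith [missProb_le_one P (K j) k])
  by_cases h : ∀ j, (r : ℝ) * (1 - missProb P (K j) k) ≤ 1
  · have h1 : r * (1 - avoidProb a K P k) / 2 ≤ hitBound a K P k r := by
      rw [← sum_mul_one_sub_missProb ha1, Finset.mul_sum, Finset.sum_div]
      refine Finset.sum_le_sum fun j _ => ?_
      rw [mul_left_comm, mul_div_assoc]
      refine mul_le_mul_of_nonneg_left ?_ (ha j).le
      have := h0 j
      have := h j
      gcongr
      linarith
    linarith [min_le_right b (r * (1 - avoidProb a K P k))]
  · push Not at h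
    obtain ⟨j, hj⟩ := h
    have h1 : a j * (r * (1 - missProb P (K j) k) / (1 + r * (1 - missProb P (K j) k))) ≤
        hitBound a K P k r :=
      Finset.single_le_sum (f := fun j => a j *
        (r * (1 - missProb P (K j) k) / (1 + r * (1 - missProb P (K j) k))))
        (fun j _ => mul_nonneg (ha j).le (div_nonneg (h0 j) (by linarith [h0 j])))
        (Finset.mem_univ j)
    have h2 : 1 / 2 ≤ r * (1 - missProb P (K j) k) / (1 + r * (1 - missProb P (K j) k)) := by
      rw [div_le_div_iff₀ (by norm_num) (by linarith)]
      linarith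
    have h3 := mul_le_mul_of_nonneg_left h2 (ha j).le
    linarith [min_le_left b (r * (1 - avoidProb a K P k)), hba j]

/-- Turns an upper bound on λ into one on k²/P, the quantity controlling overlaps. -/
theorem sq_div_le_two_mul (hP : 0 < P) (ha : ∀ i, 0 < a i) (ha1 : ∑ i, a i = 1)
    (hk : ∀ i, k ≤ K i) (hK : ∀ i, K i ≤ P) (hkk : (k : ℝ) ^ 2 ≤ P) :
    (k : ℝ) ^ 2 / P ≤ 2 * (1 - avoidProb a K P k) := by
  have hP' : (0 : ℝ) < P := by exact_mod_cast hP
  have h := avoidProb_le_exp hP ha ha1 hk hK k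
  have hx0 : (0 : ℝ) ≤ k ^ 2 / P := by positivity
  have hx1 : (k : ℝ) ^ 2 / P ≤ 1 := (div_le_one hP').2 hkk
  rw [show (k / P * k : ℝ) = k ^ 2 / P by ring] at h
  generalize (k : ℝ) ^ 2 / P = x at h hx0 hx1 ⊢
  have h2 : Real.exp (-x) ≤ 1 - x / 2 := by
    rw [Real.exp_neg, inv_le_iff_one_le_mul₀ (Real.exp_pos x)]
    nlinarith [Real.add_one_le_exp x]
  linarith

/-! ### Large sets -/

theorem choose_mul_iterAvg_le_of_large (hP : 0 < P) (hkP : k ≤ P) (ha : ∀ i, 0 < a i)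
    (ha1 : ∑ i, a i = 1) (hk : ∀ i, k ≤ K i) (hK : ∀ i, K i ≤ P) (hr : 1 ≤ r) (hrn : r ≤ n / 2)
    {c ε : ℝ} (hc : 0 < c) (hcP : c * n ≤ P) (hε1 : ε ≤ 1) (hz : (P : ℝ) / 4 < r * k)
    (h1 : 4 * Real.exp 1 * k / c * (1 / 2) ^ k ≤ ε)
    (h2 : 2 * Real.exp (-(k / 32 : ℝ)) ≤ ε) :
    (n.choose r : ℝ) *
      iterAvg k r (fun U : Finset (Fin P) => avoidProb a K P U.card ^ (n - r)) ∅ ≤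
        2 * ε ^ r := by
  classical
  have hP' : (0 : ℝ) < P := by exact_mod_cast hP
  have hr' : (0 : ℝ) < r := by exact_mod_cast hr
  have hε : 0 < ε := lt_of_lt_of_le (by positivity) h2
  set C : ℝ := (16 : ℝ) ^ ((P : ℝ) / 16) with hC
  set h0 : ℝ := Real.exp (-(k / 32 * n : ℝ)) with hh0
  -- If U covers at most P/16 keys, C cancels 16^(-|U|) and the trivial bound 1 suffices; if it
  -- covers more, the n - r ≥ n/2 outside nodes give exp(-kn/32).
  have hb : ∀ U : Finset (Fin P), avoidProb a K P U.card ^ (n - r) ≤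
      C * (if (U.card : ℝ) ≤ P / 16 then (1 / 16 : ℝ) ^ U.card else 0) + h0 := by
    intro U
    split_ifs with hU
    · have e1 : avoidProb a K P U.card ^ (n - r) ≤ 1 := by
        refine pow_le_one₀ (avoidProb_nonneg ha _) ?_
        rw [← ha1]
        exact Finset.sum_le_sum fun j _ =>
          mul_le_of_le_one_right (ha j).le (missProb_le_one _ _ _)
      have e2 : (1 : ℝ) ≤ C * (1 / 16 : ℝ) ^ U.card := by
        rw [one_div, inv_pow, ← div_eq_mul_inv, le_div_iff₀ (by positivity), one_mul,
          ← Real.rpow_natCast]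
        exact Real.rpow_le_rpow_of_exponent_le (by norm_num) hU
      have : 0 < h0 := Real.exp_pos _
      linarith
    · push Not at hU
      rw [mul_zero, zero_add]
      refine (avoidProb_pow_le_exp hP ha ha1 hk hK _ _).trans (Real.exp_le_exp.2 ?_)
      rw [neg_le_neg_iff]
      have e1 : (n : ℝ) / 2 ≤ ((n - r : ℕ) : ℝ) := by
        rw [Nat.cast_sub (by omega)]
        have : (r : ℝ) ≤ n / 2 := (Nat.cast_le.2 hrn).trans Nat.cast_div_le
        linarith
      calc (k / 32 * n : ℝ) = (n / 2) * (k / P) * (P / 16) := by field_simp; ring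
        _ ≤ _ := by gcongr
  have hmain := (iterAvg_mono (k := k) (r := r) hb ∅)
  rw [iterAvg_add_const hkP, iterAvg_const_mul] at hmain
  have hcut := iterAvg_cutoff_le hP hkP (y := 1 / 16) (by norm_num) (by norm_num)
    (M := (P : ℝ) / 16) (by positivity) r ∅
  rw [if_pos (by simp; positivity)] at hcut
  have e3 : (1 / 16 + (1 - 1 / 16) * ((P : ℝ) / 16 / P)) ≤ 1 / 8 := by
    rw [div_div, mul_comm (16 : ℝ), ← div_div, div_self hP'.ne']
    norm_num
  -- Here 16^(P/16) = 2^(P/4) and P/4 < rk. Against the contraction 1/8 this leaves 1/4 per key.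
  have hC2 : C ≤ 2 ^ (k * r) := by
    rw [hC, show (16 : ℝ) = 2 ^ (4 : ℝ) by norm_num, ← Real.rpow_mul (by norm_num),
      ← Real.rpow_natCast]
    refine Real.rpow_le_rpow_of_exponent_le (by norm_num) ?_
    push_cast
    linarith
  have hfirst : (n.choose r : ℝ) * (C * iterAvg k r (fun U : Finset (Fin P) =>
      if (U.card : ℝ) ≤ P / 16 then (1 / 16 : ℝ) ^ U.card else 0) ∅) ≤ ε ^ r := by
    have e4 : C * iterAvg k r (fun U : Finset (Fin P) =>
        if (U.card : ℝ) ≤ P / 16 then (1 / 16 : ℝ) ^ U.card else 0) ∅ ≤ (1 / 4) ^ (k * r) := by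
      calc _ ≤ C * (1 / 8 : ℝ) ^ (k * r) := by
            refine mul_le_mul_of_nonneg_left (hcut.trans ?_) (by positivity)
            simp only [Finset.card_empty, pow_zero, mul_one]
            gcongr
        _ ≤ 2 ^ (k * r) * (1 / 8 : ℝ) ^ (k * r) := by gcongr
        _ = _ := by rw [← mul_pow]; norm_num
    have e5 : Real.exp 1 * n / r * (1 / 4) ^ k ≤ ε := by
      refine le_trans ?_ h1
      have e6 : Real.exp 1 * n / r ≤ 4 * Real.exp 1 * k / c := by
        rw [div_le_div_iff₀ hr' hc]
        have : c * n ≤ 4 * (r * k) := by linarith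
        calc Real.exp 1 * n * c = Real.exp 1 * (c * n) := by ring
          _ ≤ Real.exp 1 * (4 * (r * k)) := by gcongr
          _ = _ := by ring
      gcongr
      norm_num
    calc _ ≤ (Real.exp 1 * n / r) ^ r * (1 / 4) ^ (k * r) := by
          refine mul_le_mul_of_nonneg (choose_le_exp_mul_div_pow hr) e4 (by positivity)
            (by positivity)
      _ = (Real.exp 1 * n / r * (1 / 4) ^ k) ^ r := by rw [mul_pow, pow_mul]
      _ ≤ ε ^ r := by gcongr
  have hsecond : (n.choose r : ℝ) * h0 ≤ ε ^ r := by
    have e7 : (n.choose r : ℝ) ≤ 2 ^ n := by exact_mod_cast Nat.choose_le_two_pow n r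
    calc _ ≤ 2 ^ n * h0 := by gcongr
      _ = (2 * Real.exp (-(k / 32 : ℝ))) ^ n := by
          rw [mul_pow, ← Real.exp_nat_mul, hh0]; congr 2; ring
      _ ≤ ε ^ n := by gcongr
      _ ≤ ε ^ r := pow_le_pow_of_le_one hε.le hε1 (by omega)
  calc _ ≤ (n.choose r : ℝ) * (C * iterAvg k r (fun U : Finset (Fin P) =>
        if (U.card : ℝ) ≤ P / 16 then (1 / 16 : ℝ) ^ U.card else 0) ∅ + h0) :=
        mul_le_mul_of_nonneg_left hmain (by positivity)
    _ ≤ 2 * ε ^ r := by rw [mul_add]; linarith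

/-! ### Small sets -/

-- Each case plays C(n,r), about (en/r)^r, against an exponent. The crude estimate works if n/r ≤
-- exp(w/8), if `hitBound` is saturated (b n/r ≤ nλ), if β ≥ 15 L, or if r ≥ n^(15/16); the fine
-- estimate covers the rest.
set_option maxHeartbeats 1000000 in
theorem choose_mul_iterAvg_le_of_small (hP : 0 < P) (hkP : k ≤ P) (hk1 : 1 ≤ k)
    (ha : ∀ i, 0 < a i)
    (ha1 : ∑ i, a i = 1) (hk : ∀ i, k ≤ K i) (hK : ∀ i, K i ≤ P) (hr : 1 ≤ r) (hrn : r ≤ n / 2)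
    {b : ℝ} (hb : 0 < b) (hba : ∀ i, b ≤ a i)
    {c ε w L β : ℝ} (hc : 0 < c) (hcP : c * n ≤ P) (hz : (r * k / P : ℝ) ≤ 1 / 4)
    (hL : Real.exp L = n) (hw : w ≤ k ^ 2 * n / P) (hkk : (k : ℝ) ^ 2 ≤ P)
    (hβ : 1 - avoidProb a K P k = (L + β) / n)
    (hβ0 : 0 ≤ β) (hL0 : 0 ≤ L) (hk512 : 512 ≤ k)
    (h1 : 4 * Real.exp 1 * k / c * (1 / 2) ^ k ≤ ε)
    (h2 : Real.exp 1 * Real.exp (-(w / 8)) ≤ ε)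
    (h3 : ∀ x, Real.exp (w / 8) ≤ x → Real.exp 1 * x * Real.exp (-(b * x / 8)) ≤ ε)
    (h4 : Real.exp 1 * Real.exp (-(L / 16)) ≤ ε)
    (h5 : (16 * L + 256 * L ^ 2 / b) * Real.exp (-(L / 16)) ≤ 1)
    (h6 : 32 * L * Real.exp (-(L / 32)) ≤ 1)
    (h7 : Real.exp (2 - β) ≤ ε) :
    (n.choose r : ℝ) *
      iterAvg k r (fun U : Finset (Fin P) => avoidProb a K P U.card ^ (n - r)) ∅ ≤ ε ^ r := by
  have hP' : (0 : ℝ) < P := by exact_mod_cast hP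
  have hr' : (0 : ℝ) < r := by exact_mod_cast hr
  have hk' : (0 : ℝ) < k := by exact_mod_cast hk1
  have hn' : (0 : ℝ) < n := by rw [← hL]; exact Real.exp_pos L
  have hK1 : ∀ i, 1 ≤ K i := fun i => hk1.trans (hk i)
  have hr2 : (r : ℝ) ≤ n / 2 := (Nat.cast_le.2 hrn).trans Nat.cast_div_le
  have hN : ((n - r : ℕ) : ℝ) = n - r := Nat.cast_sub (by omega)
  set lam := 1 - avoidProb a K P k with hlam
  have hnl : n * lam = L + β := by rw [hβ]; field_simp
  have hlam0 : 0 ≤ lam := by rw [hβ]; positivity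
  -- the contribution of overlapping rings
  have hover : Real.exp 1 * n / r * (2 * (r * k / P)) ^ k ≤ ε := by
    refine le_trans ?_ h1
    -- One factor 2rk/P absorbs n/r through P ≥ c n; each of the others is at most 1/2.
    obtain ⟨l, rfl⟩ := Nat.exists_eq_add_of_le' hk1
    rw [pow_succ, pow_succ]
    have e1 : (2 * (r * (l + 1 : ℕ) / P) : ℝ) ^ l ≤ (1 / 2) ^ l := by
      gcongr
      linarith
    have e2 : Real.exp 1 * n / r * (2 * (r * (l + 1 : ℕ) / P)) ≤
        2 * Real.exp 1 * (l + 1 : ℕ) / c := by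
      rw [show Real.exp 1 * n / r * (2 * (r * (l + 1 : ℕ) / P) : ℝ) =
        2 * Real.exp 1 * (l + 1 : ℕ) * n / P by field_simp, div_le_div_iff₀ hP' hc]
      calc 2 * Real.exp 1 * (l + 1 : ℕ) * n * c = 2 * Real.exp 1 * (l + 1 : ℕ) * (c * n) := by ring
        _ ≤ _ := by gcongr
    calc _ = Real.exp 1 * n / r * (2 * (r * (l + 1 : ℕ) / P)) * (2 * (r * (l + 1 : ℕ) / P)) ^ l := by
          ring
      _ ≤ 2 * Real.exp 1 * (l + 1 : ℕ) / c * (1 / 2) ^ l := by gcongr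
      _ = _ := by ring
  by_cases hcase1 : (n : ℝ) / r ≤ Real.exp (w / 8)
  · refine choose_mul_iterAvg_le_of_crude hP hkP hr (θ := (n - r : ℕ) * (k / P)) (by positivity)
      (fun u _ => avoidProb_pow_le_exp hP ha ha1 hk hK _ _) hz hover ?_
    refine le_trans ?_ h2
    have e1 : w / 4 ≤ (n - r : ℕ) * (k / P) * k / 2 := by
      rw [hN]
      calc w / 4 ≤ (k ^ 2 * n / P) / 4 := by gcongr
        _ = (n / 2) * (k / P) * k / 2 := by ring
        _ ≤ _ := by
          have : (n : ℝ) / 2 ≤ n - r := by linarith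
          gcongr
    calc _ = Real.exp 1 * (n / r) * Real.exp (-((n - r : ℕ) * (k / P) * k / 2)) := by ring
      _ ≤ Real.exp 1 * Real.exp (w / 8) * Real.exp (-(w / 4)) := by gcongr
      _ = _ := by rw [mul_assoc, ← Real.exp_add]; congr 2; ring
  push Not at hcase1
  set H := hitBound a K P k r with hH
  have hH0 : 0 ≤ H := hitBound_nonneg ha
  have hθ : (0 : ℝ) ≤ (n - r : ℕ) * H / (r * k) := by positivity
  have hθk : ((n - r : ℕ) * H / (r * k)) * k = (n - r) * (H / r) := by
    rw [hN]; field_simp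
  have hcrude : Real.exp 1 * n / r * Real.exp (-(min (b * (n / r)) (n * lam) / 8)) ≤ ε →
      (n.choose r : ℝ) * iterAvg k r
        (fun U : Finset (Fin P) => avoidProb a K P U.card ^ (n - r)) ∅ ≤ ε ^ r := by
    intro h
    refine choose_mul_iterAvg_le_of_crude hP hkP hr hθ
      (fun u hu => avoidProb_pow_le_exp_hitBound ha ha1 hK1 hK hk1 hr _ hu) hz hover
      (le_trans ?_ h)
    rw [hθk]
    have e1 : min (b * (n / r)) (n * lam) / 8 ≤ (n - r) * (H / r) / 2 := by
      have e2 := half_min_le_hitBound (K := K) (P := P) (k := k) (r := r) ha ha1 hba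
      calc min (b * (n / r)) (n * lam) / 8
          = (n / 2) * ((min b (r * lam) / 2) / r) / 2 := by
            rw [show b * ((n : ℝ) / r) = n / r * b by ring,
              show (n : ℝ) * lam = n / r * (r * lam) by field_simp,
              ← mul_min_of_nonneg _ _ (by positivity)]
            ring
        _ ≤ (n - r) * (H / r) / 2 := by
            have : (n : ℝ) / 2 ≤ n - r := by linarith
            have hmin : 0 ≤ min b (r * lam) := le_min hb.le (by positivity)
            have hnr : (0 : ℝ) ≤ n - r := by linarith
            gcongr
    gcongr
  by_cases hcase2 : b * (n / r) ≤ n * lam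
  · refine hcrude ?_
    rw [min_eq_left hcase2]
    have := h3 _ hcase1.le
    rwa [mul_div_assoc]
  push Not at hcase2
  rw [min_eq_right hcase2.le, hnl] at hcrude
  by_cases hcase3 : 16 * L ≤ L + β
  · refine hcrude (le_trans ?_ h4)
    have hr1 : (1 : ℝ) ≤ r := by exact_mod_cast hr
    calc Real.exp 1 * n / r * Real.exp (-((L + β) / 8)) ≤
        Real.exp 1 * n / 1 * Real.exp (-((16 * L) / 8)) := by gcongr
      _ = Real.exp 1 * Real.exp (-L) := by
          rw [← hL, div_one, mul_assoc, ← Real.exp_add]; congr 2; ring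
      _ ≤ _ := by gcongr; linarith
  push Not at hcase3
  by_cases hcase4 : n * Real.exp (-(L / 16)) ≤ r
  · refine hcrude (le_trans ?_ h4)
    calc Real.exp 1 * n / r * Real.exp (-((L + β) / 8)) ≤
        Real.exp 1 * n / (n * Real.exp (-(L / 16))) * Real.exp (-(L / 8)) := by
          gcongr; linarith
      _ = Real.exp 1 * Real.exp (L / 16) * Real.exp (-(L / 8)) := by
          rw [Real.exp_neg (L / 16)]; field_simp
      _ = _ := by rw [mul_assoc, ← Real.exp_add]; congr 2; ring
  push Not at hcase4
  -- The 2 in exp(2 - β) is 1 for the error in the exponent plus 1 for the overlap correction.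
  refine choose_mul_iterAvg_le_of_fine hP hkP hθ
    (fun u hu => avoidProb_pow_le_exp_hitBound ha ha1 hK1 hK hk1 hr _ hu) (le_trans ?_ h7)
  rw [hθk]
  have hrs : (r : ℝ) / n ≤ Real.exp (-(L / 16)) := by
    rw [div_le_iff₀ hn']; linarith
  have hlamL : lam ≤ 16 * L / n := by
    rw [le_div_iff₀ hn']; linarith
  -- lower bound on the exponent
  have hlow : L + β - (16 * L + 256 * L ^ 2 / b) * (r / n) ≤ (n - r) * (H / r) := by
    have e1 := le_hitBound (K := K) (P := P) (k := k) (r := r) ha ha1 hb hba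
    have e2 : lam - r * (lam ^ 2 / b) ≤ H / r := by
      rw [le_div_iff₀ hr']
      calc _ = r * lam - r ^ 2 * (lam ^ 2 / b) := by ring
        _ ≤ _ := e1
    have e3 : (n - r : ℝ) * (lam - r * (lam ^ 2 / b)) ≤ (n - r) * (H / r) :=
      mul_le_mul_of_nonneg_left e2 (by linarith)
    have e4 : (n : ℝ) * lam - r * lam - n * (r * (lam ^ 2 / b)) ≤
        (n - r : ℝ) * (lam - r * (lam ^ 2 / b)) := by
      have : (0 : ℝ) ≤ r * (r * (lam ^ 2 / b)) := by positivity
      linarith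
    have e5 : r * lam ≤ 16 * L * (r / n) := by
      calc r * lam ≤ r * (16 * L / n) := by gcongr
        _ = _ := by ring
    have e6 : n * (r * (lam ^ 2 / b)) ≤ 256 * L ^ 2 / b * (r / n) := by
      calc n * (r * (lam ^ 2 / b)) ≤ n * (r * ((16 * L / n) ^ 2 / b)) := by gcongr
        _ = _ := by field_simp; ring
    linarith
  have hlow2 : (16 * L + 256 * L ^ 2 / b) * (r / n) ≤ 1 :=
    le_trans (by gcongr) h5
  -- upper bound on the overlap correction
  have hup : k * (r * k / P) * Real.exp ((n - r : ℕ) * H / (r * k)) ≤ 1 := by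
    refine le_trans ?_ h6
    have e1 : (k : ℝ) ^ 2 / P ≤ 32 * L / n := by
      have e5 := sq_div_le_two_mul hP ha ha1 hk hK hkk
      have : 32 * L / n = 2 * (16 * L / n) := by ring
      linarith
    have e2 : (n - r : ℕ) * H / (r * k) ≤ L / 32 := by
      have e3 : (n - r : ℕ) * H / (r * k) * k ≤ 16 * L := by
        rw [hθk]
        have e4 : H / r ≤ lam := by
          rw [div_le_iff₀ hr', mul_comm]
          exact hitBound_le ha ha1
        calc (n - r : ℝ) * (H / r) ≤ n * lam := by gcongr; linarith
          _ ≤ 16 * L := by linarith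
      -- Since θ k ≤ 16 L, this gives θ ≤ L/32, so exp θ ≤ n^(1/32) loses to r/n ≤ n^(-1/16).
      have e5 : (512 : ℝ) ≤ k := by exact_mod_cast hk512
      have e6 := mul_le_mul_of_nonneg_left e5 hθ
      generalize (n - r : ℕ) * H / (r * k) = θ at e3 e6 ⊢
      linarith
    calc k * (r * k / P) * Real.exp ((n - r : ℕ) * H / (r * k))
        = r * (k ^ 2 / P) * Real.exp ((n - r : ℕ) * H / (r * k)) := by ring
      _ ≤ r * (32 * L / n) * Real.exp (L / 32) := by gcongr
      _ = 32 * L * (r / n) * Real.exp (L / 32) := by ring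
      _ ≤ 32 * L * Real.exp (-(L / 16)) * Real.exp (L / 32) := by gcongr
      _ = _ := by rw [mul_assoc, ← Real.exp_add]; congr 2; ring
  have hcomb : ∀ x, (n : ℝ) * Real.exp x = Real.exp (L + x) := fun x => by rw [Real.exp_add, hL]
  rw [hcomb]
  exact Real.exp_le_exp.2 (by linarith)

end

/-! ### The one law -/

theorem tendsto_pow_mul_exp_neg_mul (j : ℕ) {s : ℝ} (hs : 0 < s) :
    Tendsto (fun x : ℝ => x ^ j * Real.exp (-(s * x))) atTop (𝓝 0) := by
  refine (tendsto_rpow_mul_exp_neg_mul_atTop_nhds_zero j s hs).congr fun x => ?_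
  rw [Real.rpow_natCast, neg_mul]

theorem tendsto_log_natCast : Tendsto (fun n : ℕ => Real.log n) atTop atTop :=
  Real.tendsto_log_atTop.comp tendsto_natCast_atTop_atTop

/-- The square of the key ring size dominates the ratio of pool size to number of nodes. -/
theorem tendsto_sq_mul_div {P k : ℕ → ℕ} (hPpos : ∀ n, 1 ≤ n → 0 < P n)
    (h : (fun n : ℕ => √((P n : ℝ) / (n : ℝ))) =o[atTop] fun n : ℕ => (k n : ℝ)) :
    Tendsto (fun n : ℕ => (k n : ℝ) ^ 2 * n / P n) atTop atTop := by
  refine tendsto_atTop.2 fun B => ?_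
  have hB : 0 < max B 1 := lt_max_of_lt_right one_pos
  filter_upwards [h.bound (show 0 < 1 / √(max B 1) by positivity), eventually_ge_atTop 1]
    with n hn hn1
  have hP : (0 : ℝ) < P n := by exact_mod_cast hPpos n hn1
  have hn0 : (0 : ℝ) < n := by exact_mod_cast hn1
  rw [Real.norm_of_nonneg (Real.sqrt_nonneg _), Real.norm_of_nonneg (Nat.cast_nonneg _),
    one_div, inv_mul_eq_div, le_div_iff₀ (by positivity), ← Real.sqrt_mul (by positivity)] at hn
  have h2 := Real.sqrt_le_left (by positivity) |>.1 hn
  refine (le_max_left B 1).trans ?_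
  rw [le_div_iff₀ hP]
  rw [div_mul_eq_mul_div, div_le_iff₀ hn0] at h2
  linarith

/-- From P ≥ c n, k² is at least c times k² n / P. -/
theorem tendsto_size {P k : ℕ → ℕ} (hPpos : ∀ n, 1 ≤ n → 0 < P n) {c : ℝ} (hc : 0 < c)
    (hcP : ∀ᶠ n : ℕ in atTop, c * n ≤ P n)
    (h : Tendsto (fun n : ℕ => (k n : ℝ) ^ 2 * n / P n) atTop atTop) :
    Tendsto k atTop atTop := by
  refine tendsto_atTop.2 fun B => ?_
  filter_upwards [h.eventually_ge_atTop ((B : ℝ) ^ 2 / c), hcP, eventually_ge_atTop 1]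
    with n hn hcn hn1
  have hP : (0 : ℝ) < P n := by exact_mod_cast hPpos n hn1
  have hn0 : (0 : ℝ) < n := by exact_mod_cast hn1
  rw [div_le_div_iff₀ hc hP] at hn
  have h1 : (B : ℝ) ^ 2 * (c * n) ≤ (k n : ℝ) ^ 2 * (c * n) := by
    calc (B : ℝ) ^ 2 * (c * n) ≤ B ^ 2 * P n := by gcongr
      _ ≤ _ := by linarith
  have h2 := le_of_mul_le_mul_right h1 (by positivity)
  exact_mod_cast (pow_le_pow_iff_left₀ (Nat.cast_nonneg B) (Nat.cast_nonneg (k n)) two_ne_zero).1 h2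

theorem tendsto_connProb_one {m : ℕ} (hm : 0 < m) {a : Fin m → ℝ} (ha : ∀ i, 0 < a i)
    (ha1 : ∑ i, a i = 1) {P : ℕ → ℕ} {K : ℕ → Fin m → ℕ} {k : ℕ → ℕ} {β : ℕ → ℝ}
    (hk1 : ∀ n, 1 ≤ n → 1 ≤ k n) (hk : ∀ n, 1 ≤ n → ∀ i, k n ≤ K n i)
    (hK : ∀ n, 1 ≤ n → ∀ i, K n i ≤ P n) {c : ℝ} (hc : 0 < c)
    (hcP : ∀ᶠ n : ℕ in atTop, c * n ≤ P n)
    (hw : Tendsto (fun n : ℕ => (k n : ℝ) ^ 2 * n / P n) atTop atTop)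
    (hkk : ∀ᶠ n : ℕ in atTop, (k n : ℝ) ^ 2 ≤ P n)
    (hβ : ∀ n : ℕ, 1 ≤ n → 1 - avoidProb a (K n) (P n) (k n) = (Real.log n + β n) / n)
    (hβt : Tendsto β atTop atTop) :
    Tendsto (fun n => connProb n a (K n) (P n)) atTop (𝓝 1) := by
  have hkP : ∀ n, 1 ≤ n → k n ≤ P n := fun n hn => (hk n hn ⟨0, hm⟩).trans (hK n hn _)
  have hPpos : ∀ n, 1 ≤ n → 0 < P n := fun n hn => (hk1 n hn).trans (hkP n hn)
  have hkt := tendsto_size hPpos hc hcP hw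
  have hktR : Tendsto (fun n => (k n : ℝ)) atTop atTop := tendsto_natCast_atTop_atTop.comp hkt
  have hLt := tendsto_log_natCast
  have : Nonempty (Fin m) := ⟨⟨0, hm⟩⟩
  obtain ⟨i0, hi0⟩ := Finite.exists_min a
  have hb := ha i0
  set b := a i0 with hbdef
  -- The terms 2ε^r over r ≥ 1 sum to at most 4ε when ε ≤ 1/2.
  suffices hmain : ∀ ε : ℝ, 0 < ε → ε ≤ 1 / 2 →
      ∀ᶠ n : ℕ in atTop, 1 - connProb n a (K n) (P n) ≤ 4 * ε by
    rw [Metric.tendsto_atTop']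
    intro δ hδ
    have hε : 0 < min (δ / 8) (1 / 2) := lt_min (by positivity) (by norm_num)
    obtain ⟨N, hN⟩ := eventually_atTop.1
      ((hmain _ hε (min_le_right _ _)).and (eventually_ge_atTop 1))
    refine ⟨N, fun n hn => ?_⟩
    obtain ⟨h1, h2⟩ := hN n hn.le
    have h3 := prob_le_one ha ha1 (hK n h2) {ω | (graph ω).Connected} (n := n)
    have h4 : connProb n a (K n) (P n) ≤ 1 := h3
    rw [Real.dist_eq, abs_sub_comm, abs_of_nonneg (by linarith)]
    have := min_le_left (δ / 8) (1 / 2)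
    linarith
  intro ε hε hε2
  have e1 : ∀ᶠ n in atTop, 4 * Real.exp 1 * k n / c * (1 / 2) ^ (k n) ≤ ε := by
    have h1 := (tendsto_self_mul_const_pow_of_lt_one (r := (1 / 2 : ℝ)) (by norm_num)
      (by norm_num)).const_mul (4 * Real.exp 1 / c)
    rw [mul_zero] at h1
    filter_upwards [(h1.comp hkt).eventually_le_const hε] with n hn
    refine le_trans (le_of_eq ?_) hn
    simp only [Function.comp_apply]
    ring
  have hexp : ∀ {f : ℕ → ℝ} (s : ℝ), 0 < s → Tendsto f atTop atTop →
      Tendsto (fun n => Real.exp (-(f n / s))) atTop (𝓝 0) := fun s hs hf =>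
    Real.tendsto_exp_neg_atTop_nhds_zero.comp (hf.atTop_div_const hs)
  have e2 : ∀ᶠ n in atTop, 2 * Real.exp (-(k n / 32 : ℝ)) ≤ ε := by
    have h1 := (hexp 32 (by norm_num) hktR).const_mul 2
    rw [mul_zero] at h1
    exact h1.eventually_le_const hε
  have e3 : ∀ᶠ n : ℕ in atTop, Real.exp 1 * Real.exp (-((k n : ℝ) ^ 2 * n / P n / 8)) ≤ ε := by
    have h1 := (hexp 8 (by norm_num) hw).const_mul (Real.exp 1)
    rw [mul_zero] at h1
    exact h1.eventually_le_const hε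
  have e4 : ∀ᶠ n : ℕ in atTop, ∀ x, Real.exp ((k n : ℝ) ^ 2 * n / P n / 8) ≤ x →
      Real.exp 1 * x * Real.exp (-(b * x / 8)) ≤ ε := by
    have h1 := (tendsto_pow_mul_exp_neg_mul 1 (show 0 < b / 8 by positivity)).const_mul
      (Real.exp 1)
    rw [mul_zero] at h1
    obtain ⟨X, hX⟩ := eventually_atTop.1 (h1.eventually_le_const hε)
    have h2 := Real.tendsto_exp_atTop.comp (hw.atTop_div_const (show (0 : ℝ) < 8 by norm_num))
    filter_upwards [h2.eventually_ge_atTop X] with n hn x hx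
    refine le_trans (le_of_eq ?_) (hX x (hn.trans hx))
    rw [pow_one, mul_assoc]
    congr 3
    ring
  have e5 : ∀ᶠ n : ℕ in atTop, Real.exp 1 * Real.exp (-(Real.log n / 16)) ≤ ε := by
    have h1 := (hexp 16 (by norm_num) hLt).const_mul (Real.exp 1)
    rw [mul_zero] at h1
    exact h1.eventually_le_const hε
  have e6 : ∀ᶠ n : ℕ in atTop, (16 * Real.log n + 256 * Real.log n ^ 2 / b) *
      Real.exp (-(Real.log n / 16)) ≤ 1 := by
    have h1 := ((tendsto_pow_mul_exp_neg_mul 1 (show (0 : ℝ) < 1 / 16 by norm_num)).const_mul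
      16).add ((tendsto_pow_mul_exp_neg_mul 2 (show (0 : ℝ) < 1 / 16 by norm_num)).const_mul
      (256 / b))
    rw [mul_zero, mul_zero, add_zero] at h1
    filter_upwards [(h1.comp hLt).eventually_le_const one_pos] with n hn
    refine le_trans (le_of_eq ?_) hn
    simp only [Function.comp_apply]
    rw [one_div_mul_eq_div]
    ring
  have e7 : ∀ᶠ n : ℕ in atTop, 32 * Real.log n * Real.exp (-(Real.log n / 32)) ≤ 1 := by
    have h1 := (tendsto_pow_mul_exp_neg_mul 1 (show (0 : ℝ) < 1 / 32 by norm_num)).const_mul 32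
    rw [mul_zero] at h1
    filter_upwards [(h1.comp hLt).eventually_le_const one_pos] with n hn
    refine le_trans (le_of_eq ?_) hn
    simp only [Function.comp_apply]
    rw [one_div_mul_eq_div]
    ring
  have e8 : ∀ᶠ n : ℕ in atTop, Real.exp (2 - β n) ≤ ε := by
    have h1 : Tendsto (fun n => 2 - β n) atTop atBot := by
      simpa [sub_eq_add_neg] using
        tendsto_atBot_add_const_left atTop (2 : ℝ) (tendsto_neg_atTop_atBot.comp hβt)
    exact (Real.tendsto_exp_atBot.comp h1).eventually_le_const hε
  filter_upwards [e1, e2, e3, e4, e5, e6, e7, e8, hcP, hkk, hβt.eventually_ge_atTop 0,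
    hkt.eventually_ge_atTop 512, eventually_ge_atTop 1]
    with n h1 h2 h3 h4 h5 h6 h7 h8 hcn hkkn hβn hk512 hn
  have hn0 : (0 : ℝ) < n := by exact_mod_cast hn
  have hP' : (0 : ℝ) < P n := by exact_mod_cast hPpos n hn
  refine (one_sub_connProb_le hn ha ha1 (hk n hn) (hK n hn)).trans ?_
  have hterm : ∀ r ∈ Finset.Icc 1 (n / 2), (n.choose r : ℝ) * iterAvg (k n) r
      (fun U : Finset (Fin (P n)) => avoidProb a (K n) (P n) U.card ^ (n - r)) ∅ ≤
        2 * ε ^ r := by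
    intro r hr
    rw [Finset.mem_Icc] at hr
    by_cases hz : (r * k n / P n : ℝ) ≤ 1 / 4
    · have h := choose_mul_iterAvg_le_of_small (hPpos n hn) (hkP n hn) (hk1 n hn) ha ha1 (hk n hn)
        (hK n hn) hr.1 hr.2 hb hi0 hc hcn hz (Real.exp_log hn0) le_rfl hkkn (hβ n hn) hβn
        (Real.log_natCast_nonneg n) hk512 h1 h3 h4 h5 h6 h7 h8
      have : 0 ≤ ε ^ r := by positivity
      linarith
    · rw [not_le, lt_div_iff₀ hP'] at hz
      exact choose_mul_iterAvg_le_of_large (hPpos n hn) (hkP n hn) ha ha1 (hk n hn) (hK n hn)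
        hr.1 hr.2 hc hcn (by linarith) (by linarith) h1 h2
  refine (Finset.sum_le_sum hterm).trans ?_
  rw [← Finset.mul_sum, show Finset.Icc 1 (n / 2) = Finset.Ico 1 (n / 2 + 1) by
    ext; simp]
  have hg := geom_sum_Ico_le_of_lt_one (m := 1) (n := n / 2 + 1) hε.le
    (show ε < 1 by linarith)
  have hg2 : ε ^ 1 / (1 - ε) ≤ 2 * ε := by
    rw [div_le_iff₀ (by linarith)]
    nlinarith
  linarith

/-! ### The zero law -/

section

variable {n m : ℕ} {a : Fin m → ℝ} {K : Fin m → ℕ} {P : ℕ}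

/-- The event that the nodes of `S` belong to group `i` and are isolated in the graph. -/
def IsolatedInGroup (i : Fin m) (S : Finset (Fin n)) : Set (Outcome n m P) :=
  {ω | ω ∈ Separated S ∧ (∀ v : S, (ω v).1 = i) ∧
    ∀ v w : S, v ≠ w → Disjoint (ω v).2 (ω w).2}

-- Disjoint rings of size K i cover exactly |S| K i keys, so the avoidance factor is constant and
-- comes out of the sum.
open Classical in
theorem prob_isolatedInGroup (i : Fin m) (S : Finset (Fin n)) :
    prob n a K P (IsolatedInGroup i S) = avoidProb a K P (S.card * K i) ^ (n - S.card) *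
      ∑ σ : S → Fin m × Finset (Fin P), (∏ v, nodeWeight a K P (σ v)) *
        (if (∀ v, (σ v).1 = i) ∧ ∀ v w, v ≠ w → Disjoint (σ v).2 (σ w).2 then 1 else 0) := by
  have h := sum_weight_separated (a := a) (K := K) (P := P) S fun σ =>
    if (∀ v, (σ v).1 = i) ∧ ∀ v w, v ≠ w → Disjoint (σ v).2 (σ w).2 then 1 else 0
  have h1 : prob n a K P (IsolatedInGroup i S) = ∑ ω : Outcome n m P,
      (if ω ∈ Separated S then weight n a K P ω * (if (∀ v : S, (ω v).1 = i) ∧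
        ∀ v w : S, v ≠ w → Disjoint (ω v).2 (ω w).2 then 1 else 0) else 0) := by
    refine Finset.sum_congr rfl fun ω _ => ?_
    by_cases h1 : ω ∈ Separated S
    · by_cases h2 : (∀ v : S, (ω v).1 = i) ∧ ∀ v w : S, v ≠ w → Disjoint (ω v).2 (ω w).2
      · rw [if_pos h1, if_pos h2, mul_one, if_pos]
        exact ⟨h1, h2⟩
      · rw [if_pos h1, if_neg h2, mul_zero, if_neg]
        exact fun h => h2 h.2
    · rw [if_neg h1, if_neg fun h => h1 h.1]
  rw [h1, h, Finset.mul_sum]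
  refine Finset.sum_congr rfl fun σ _ => ?_
  split_ifs with hσ
  -- Rings of the wrong size are still outcomes, but of weight zero.
  · by_cases hw : ∏ v, nodeWeight a K P (σ v) = 0
    · rw [hw]; ring
    · have hcard : (Finset.univ.biUnion fun v => (σ v).2).card = S.card * K i := by
        rw [Finset.card_biUnion fun v _ w _ h => hσ.2 v w h, Finset.sum_const_nat (m := K i),
          Finset.card_univ, Fintype.card_coe]
        intro v _
        have hv := Finset.prod_ne_zero_iff.1 hw v (Finset.mem_univ v)
        unfold nodeWeight at hv
        rw [← hσ.1 v]
        by_contra hne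
        exact hv (if_neg hne)
      rw [hcard]
      ring
  · ring

theorem sum_nodeWeight_group (hK : ∀ i, K i ≤ P) (i : Fin m) :
    ∑ x, nodeWeight a K P x * (if x.1 = i then 1 else 0) = a i := by
  rw [sum_nodeWeight_mul fun j _ => if j = i then (1 : ℝ) else 0, Finset.sum_eq_single i]
  · have : (0 : ℝ) < P.choose (K i) := by exact_mod_cast Nat.choose_pos (hK i)
    simp [this.ne']
  · intro j _ hj
    simp [hj]
  · simp

theorem sum_prod_nodeWeight_group (hK : ∀ i, K i ≤ P) (i : Fin m) (S : Finset (Fin n)) :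
    ∑ σ : S → Fin m × Finset (Fin P), (∏ v, nodeWeight a K P (σ v)) *
      (if ∀ v, (σ v).1 = i then 1 else 0) = a i ^ S.card := by
  have h : ∀ σ : S → Fin m × Finset (Fin P), (∏ v, nodeWeight a K P (σ v)) *
      (if ∀ v, (σ v).1 = i then 1 else 0) =
      ∏ v, nodeWeight a K P (σ v) * (if (σ v).1 = i then 1 else 0) := by
    intro σ
    rw [Finset.prod_mul_distrib]
    congr 1
    split_ifs with hσ
    · rw [Finset.prod_eq_one fun v _ => if_pos (hσ v)]
    · push Not at hσ
      obtain ⟨v, hv⟩ := hσ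
      rw [Finset.prod_eq_zero (Finset.mem_univ v) (if_neg hv)]
  simp only [h]
  rw [← Fintype.prod_sum fun (_ : S) x => nodeWeight a K P x * (if x.1 = i then 1 else 0)]
  simp only [sum_nodeWeight_group hK, Finset.prod_const, Finset.card_univ, Fintype.card_coe]

/-- Drops the mutual disjointness of the rings; for one node that condition is vacuous, hence the
equality in the singleton case. -/
theorem prob_isolatedInGroup_le (ha : ∀ i, 0 < a i) (hK : ∀ i, K i ≤ P) (i : Fin m)
    (S : Finset (Fin n)) :
    prob n a K P (IsolatedInGroup i S) ≤
      avoidProb a K P (S.card * K i) ^ (n - S.card) * a i ^ S.card := by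
  classical
  rw [prob_isolatedInGroup, ← sum_prod_nodeWeight_group hK i S]
  refine mul_le_mul_of_nonneg_left (Finset.sum_le_sum fun σ _ => ?_)
    (pow_nonneg (avoidProb_nonneg ha _) _)
  refine mul_le_mul_of_nonneg_left ?_ (Finset.prod_nonneg fun _ _ => nodeWeight_nonneg ha _)
  split_ifs with h1 h2
  · exact le_rfl
  · exact absurd h1.1 h2
  · exact zero_le_one
  · exact le_rfl

theorem prob_isolatedInGroup_singleton (hK : ∀ i, K i ≤ P) (i : Fin m) (v : Fin n) :
    prob n a K P (IsolatedInGroup i {v}) = avoidProb a K P (K i) ^ (n - 1) * a i := by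
  classical
  have h := sum_prod_nodeWeight_group (a := a) hK i {v}
  rw [prob_isolatedInGroup, Finset.card_singleton, one_mul]
  rw [Finset.card_singleton, pow_one] at h
  congr 1
  rw [← h]
  refine Finset.sum_congr rfl fun σ _ => ?_
  congr 1
  refine if_congr ⟨fun h => h.1, fun h => ⟨h, fun x y hxy => absurd ?_ hxy⟩⟩ rfl rfl
  exact Subsingleton.elim x y

theorem not_connected_of_isolatedInGroup (hn : 2 ≤ n) {i : Fin m} {v : Fin n}
    {ω : Outcome n m P} (h : ω ∈ IsolatedInGroup i {v}) : ¬ (graph ω).Connected := by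
  intro hc
  have : Nontrivial (Fin n) := Fin.nontrivial_iff_two_le.2 hn
  obtain ⟨w, hw⟩ := hc.preconnected.exists_adj_of_nontrivial v
  have h1 := h.1 w (by simpa using hw.1.symm)
  rw [keys, Finset.singleton_biUnion, Finset.disjoint_iff_inter_eq_empty] at h1
  exact hw.2.ne_empty h1

theorem isolatedInGroup_inter {i : Fin m} {u v : Fin n} (huv : u ≠ v) :
    (IsolatedInGroup i {u} ∩ IsolatedInGroup i {v} : Set (Outcome n m P)) ⊆
      IsolatedInGroup i {u, v} := by
  rintro ω ⟨⟨hu, hu', -⟩, ⟨hv, hv', -⟩⟩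
  have hu1 : ∀ w, w ≠ u → Disjoint (ω u).2 (ω w).2 := by
    intro w hw
    simpa [keys] using hu w (by simpa using hw)
  have hv1 : ∀ w, w ≠ v → Disjoint (ω v).2 (ω w).2 := by
    intro w hw
    simpa [keys] using hv w (by simpa using hw)
  refine ⟨?_, ?_, ?_⟩
  · intro w hw
    simp only [Finset.mem_insert, Finset.mem_singleton, not_or] at hw
    rw [keys, Finset.disjoint_biUnion_left]
    intro x hx
    simp only [Finset.mem_insert, Finset.mem_singleton] at hx
    rcases hx with rfl | rfl
    · exact hu1 w hw.1
    · exact hv1 w hw.2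
  · rintro ⟨x, hx⟩
    simp only [Finset.mem_insert, Finset.mem_singleton] at hx
    rcases hx with rfl | rfl
    · exact hu' ⟨x, by simp⟩
    · exact hv' ⟨x, by simp⟩
  · rintro ⟨x, hx⟩ ⟨y, hy⟩ hxy
    simp only [Finset.mem_insert, Finset.mem_singleton] at hx
    have hxy' : y ≠ x := fun h => hxy (Subtype.ext h.symm)
    rcases hx with rfl | rfl
    · exact hu1 y hxy'
    · exact hv1 y hxy'

theorem prob_mono (ha : ∀ i, 0 < a i) {E F : Set (Outcome n m P)} (h : E ⊆ F) :
    prob n a K P E ≤ prob n a K P F := by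
  refine Finset.sum_le_sum fun ω _ => ?_
  have := weight_nonneg (K := K) ha ω
  split_ifs with h1 h2
  · exact le_rfl
  · exact absurd (h h1) h2
  · exact this
  · exact le_rfl

/-- The second moment bound on the probability of connectivity. -/
theorem connProb_le (hn : 2 ≤ n) (ha : ∀ i, 0 < a i) (ha1 : ∑ i, a i = 1) (hK : ∀ i, K i ≤ P)
    (i : Fin m) {μ : ℝ} (hμ : μ = n * (avoidProb a K P (K i) ^ (n - 1) * a i)) (hμ0 : 0 < μ) :
    connProb n a K P ≤
      1 / μ + n ^ 2 * (avoidProb a K P (2 * K i) ^ (n - 2) * a i ^ 2) / μ ^ 2 - 1 := by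
  classical
  let X : Outcome n m P → ℝ := fun ω => ∑ v, if ω ∈ IsolatedInGroup i {v} then 1 else 0
  have hE1 : ∑ ω, weight n a K P ω * X ω = μ := by
    simp only [X, Finset.mul_sum]
    rw [Finset.sum_comm]
    have : ∀ v : Fin n, ∑ ω : Outcome n m P,
        weight n a K P ω * (if ω ∈ IsolatedInGroup i {v} then 1 else 0) =
        avoidProb a K P (K i) ^ (n - 1) * a i := by
      intro v
      rw [← prob_isolatedInGroup_singleton hK i v]
      exact Finset.sum_congr rfl fun ω _ => by simp
    rw [Finset.sum_congr rfl fun v _ => this v, hμ]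
    simp
  have hE2 : ∑ ω, weight n a K P ω * X ω ^ 2 ≤
      μ + n ^ 2 * (avoidProb a K P (2 * K i) ^ (n - 2) * a i ^ 2) := by
    have h1 : ∑ ω, weight n a K P ω * X ω ^ 2 =
        ∑ u, ∑ v, prob n a K P (IsolatedInGroup i {u} ∩ IsolatedInGroup i {v}) := by
      have hsq : ∀ ω, weight n a K P ω * X ω ^ 2 = ∑ u, ∑ v, weight n a K P ω *
          ((if ω ∈ IsolatedInGroup i {u} then 1 else 0) *
            (if ω ∈ IsolatedInGroup i {v} then 1 else 0)) := by
        intro ω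
        rw [sq, Finset.sum_mul_sum, Finset.mul_sum]
        exact Finset.sum_congr rfl fun u _ => Finset.mul_sum _ _ _
      simp only [hsq]
      rw [Finset.sum_comm]
      refine Finset.sum_congr rfl fun u _ => ?_
      rw [Finset.sum_comm]
      refine Finset.sum_congr rfl fun v _ => Finset.sum_congr rfl fun ω _ => ?_
      by_cases hu : ω ∈ IsolatedInGroup i {u} <;> by_cases hv : ω ∈ IsolatedInGroup i {v} <;>
        simp [hu, hv]
    set q2 := avoidProb a K P (2 * K i) ^ (n - 2) * a i ^ 2 with hq2
    have hq20 : 0 ≤ q2 := mul_nonneg (pow_nonneg (avoidProb_nonneg ha _) _) (sq_nonneg _)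
    have h2 : ∀ u v, prob n a K P (IsolatedInGroup i {u} ∩ IsolatedInGroup i {v}) ≤
        (if u = v then avoidProb a K P (K i) ^ (n - 1) * a i else 0) + q2 := by
      intro u v
      split_ifs with huv
      · subst huv
        rw [Set.inter_self, prob_isolatedInGroup_singleton hK]
        linarith
      · rw [zero_add]
        refine (prob_mono ha (isolatedInGroup_inter huv)).trans ?_
        have := prob_isolatedInGroup_le (P := P) ha hK i {u, v}
        rwa [Finset.card_pair huv] at this
    rw [h1]
    refine (Finset.sum_le_sum fun u _ => Finset.sum_le_sum fun v _ => h2 u v).trans ?_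
    simp only [Finset.sum_add_distrib, Finset.sum_ite_eq, Finset.mem_univ, if_true,
      Finset.sum_const, Finset.card_univ, Fintype.card_fin, nsmul_eq_mul]
    rw [hμ]
    linarith [show (n : ℝ) ^ 2 * q2 = n * (n * q2) by ring]
  have hE0 : ∑ ω : Outcome n m P, weight n a K P ω = 1 := by
    simpa [prob] using prob_univ n a ha1 K P hK
  -- Chebyshev: connectivity forces X = 0, a deviation of μ from the mean.
  have hcheb : connProb n a K P * μ ^ 2 ≤ ∑ ω, weight n a K P ω * (X ω - μ) ^ 2 := by
    unfold connProb prob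
    rw [Finset.sum_mul]
    refine Finset.sum_le_sum fun ω _ => ?_
    have hw := weight_nonneg (K := K) ha ω
    split_ifs with hc
    · have : X ω = 0 := Finset.sum_eq_zero fun v _ =>
        if_neg fun h => not_connected_of_isolatedInGroup hn h hc
      rw [this, zero_sub, neg_sq]
    · rw [zero_mul]
      positivity
  have hvar : ∑ ω, weight n a K P ω * (X ω - μ) ^ 2 =
      ∑ ω, weight n a K P ω * X ω ^ 2 - μ ^ 2 := by
    have : ∀ ω, weight n a K P ω * (X ω - μ) ^ 2 = weight n a K P ω * X ω ^ 2 -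
        2 * μ * (weight n a K P ω * X ω) + μ ^ 2 * weight n a K P ω := fun ω => by ring
    simp only [this, Finset.sum_add_distrib, Finset.sum_sub_distrib, ← Finset.mul_sum, hE1, hE0]
    ring
  have hμ2 : 0 < μ ^ 2 := by positivity
  rw [hvar] at hcheb
  rw [← le_div_iff₀ hμ2] at hcheb
  refine hcheb.trans ?_
  have e : 1 / μ + n ^ 2 * (avoidProb a K P (2 * K i) ^ (n - 2) * a i ^ 2) / μ ^ 2 - 1 =
      (μ + n ^ 2 * (avoidProb a K P (2 * K i) ^ (n - 2) * a i ^ 2) - μ ^ 2) / μ ^ 2 := by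
    field_simp
  rw [e]
  gcongr

/-- By submultiplicativity q(2k) is at most the second moment over groups of the miss probability.
This is q(k)² plus a variance, itself at most the second moment of 1 - `missProb`. -/
theorem avoidProb_two_mul_le (ha : ∀ i, 0 < a i) (ha1 : ∑ i, a i = 1) (hK : ∀ i, K i ≤ P)
    {b : ℝ} (hb : 0 < b) (hba : ∀ i, b ≤ a i) (k : ℕ) :
    avoidProb a K P (2 * k) ≤
      avoidProb a K P k ^ 2 + (1 - avoidProb a K P k) ^ 2 / b := by
  have h1 : avoidProb a K P (2 * k) ≤ ∑ j, a j * missProb P (K j) k ^ 2 :=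
    Finset.sum_le_sum fun j _ => mul_le_mul_of_nonneg_left (missProb_mul_le (hK j) k 2) (ha j).le
  have h2 : ∑ j, a j * missProb P (K j) k ^ 2 = ∑ j, a j * (1 - missProb P (K j) k) ^ 2 +
      (2 * avoidProb a K P k - 1) := by
    have h : 2 * avoidProb a K P k - 1 = ∑ j, (2 * (a j * missProb P (K j) k) - a j) := by
      rw [Finset.sum_sub_distrib, ha1, ← Finset.mul_sum, avoidProb]
    rw [h, ← Finset.sum_add_distrib]
    exact Finset.sum_congr rfl fun j _ => by ring
  have h3 := sum_mul_sq_one_sub_missProb_le (K := K) (P := P) (k := k) ha ha1 hb hba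
  nlinarith [sq_nonneg (1 - avoidProb a K P k)]

theorem connProb_le_exp (hn : 2 ≤ n) (ha : ∀ i, 0 < a i) (ha1 : ∑ i, a i = 1)
    (hK : ∀ i, K i ≤ P) {b : ℝ} (hb : 0 < b) (hba : ∀ i, b ≤ a i) (i : Fin m) {β L : ℝ}
    (hL : Real.exp L = n) (hβ : 1 - avoidProb a K P (K i) = (L + β) / n) (hβ0 : β ≤ 0)
    (hLn : L / n ≤ 1 / 2) :
    connProb n a K P ≤ Real.exp (β + 2 * (L ^ 2 / n)) / a i +
      Real.exp (4 / b * (L ^ 2 / n)) / (1 - L / n) ^ 2 - 1 := by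
  have hn0 : (0 : ℝ) < n := by rw [← hL]; exact Real.exp_pos L
  set q := avoidProb a K P (K i) with hq
  set lam := 1 - q with hlam
  have hlam0 : 0 ≤ lam := by
    have h : q ≤ 1 := by
      rw [hq, ← ha1]
      exact Finset.sum_le_sum fun j _ => mul_le_of_le_one_right (ha j).le (missProb_le_one _ _ _)
    linarith
  have hlamL : lam ≤ L / n := by
    rw [hβ]
    gcongr
    linarith
  have hqlam : q = 1 - lam := by linarith
  have hq2 : 1 / 2 ≤ q := by linarith
  have hq0 : 0 < q := by linarith
  have hq1 : q ≤ 1 := by linarith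
  have hnlam : n * lam = L + β := by rw [hβ]; field_simp
  have hnlam2 : n * lam ^ 2 ≤ L ^ 2 / n := by
    calc n * lam ^ 2 ≤ n * (L / n) ^ 2 := by gcongr
      _ = _ := by field_simp
  have hai := ha i
  -- Valid for λ ≤ 1/2, which follows from β ≤ 0 and L/n ≤ 1/2; the quadratic term costs only L²/n
  -- after n factors.
  have hlow : Real.exp (-(lam + 2 * lam ^ 2)) ≤ q := by
    have h1 : 1 / q ≤ Real.exp (lam + 2 * lam ^ 2) := by
      have h2 : 1 / q ≤ 1 + (lam + 2 * lam ^ 2) := by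
        rw [div_le_iff₀ hq0, hqlam]
        nlinarith [mul_nonneg (sq_nonneg lam) (show 0 ≤ 1 - 2 * lam by linarith)]
      linarith [Real.add_one_le_exp (lam + 2 * lam ^ 2)]
    rw [Real.exp_neg]
    rw [one_div] at h1
    exact inv_le_of_inv_le₀ hq0 h1
  set μ : ℝ := n * (q ^ (n - 1) * a i) with hμ
  have hμ0 : 0 < μ := by positivity
  refine (connProb_le hn ha ha1 hK i hμ hμ0).trans ?_
  have hfirst : 1 / μ ≤ Real.exp (β + 2 * (L ^ 2 / n)) / a i := by
    have h1 : Real.exp (-(n * (lam + 2 * lam ^ 2))) ≤ q ^ (n - 1) := by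
      calc _ = Real.exp (-(lam + 2 * lam ^ 2)) ^ n := by rw [← Real.exp_nat_mul]; congr 1; ring
        _ ≤ q ^ n := by gcongr
        _ ≤ q ^ (n - 1) := pow_le_pow_of_le_one hq0.le hq1 (by omega)
    have h2 : Real.exp (-(β + 2 * (L ^ 2 / n))) * a i ≤ μ := by
      calc _ ≤ Real.exp (L + -(n * (lam + 2 * lam ^ 2))) * a i :=
            mul_le_mul_of_nonneg_right (Real.exp_le_exp.2 (by linarith)) hai.le
        _ = n * (Real.exp (-(n * (lam + 2 * lam ^ 2))) * a i) := by
            rw [Real.exp_add, hL]; ring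
        _ ≤ μ := mul_le_mul_of_nonneg_left (mul_le_mul_of_nonneg_right h1 hai.le) hn0.le
    rw [Real.exp_neg] at h2
    calc 1 / μ ≤ 1 / ((Real.exp (β + 2 * (L ^ 2 / n)))⁻¹ * a i) :=
          one_div_le_one_div_of_le (by positivity) h2
      _ = _ := by field_simp
  have hsecond : (n : ℝ) ^ 2 * (avoidProb a K P (2 * K i) ^ (n - 2) * a i ^ 2) / μ ^ 2 ≤
      Real.exp (4 / b * (L ^ 2 / n)) / (1 - L / n) ^ 2 := by
    have h1 : avoidProb a K P (2 * K i) ≤ q ^ 2 * Real.exp (4 / b * lam ^ 2) := by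
      calc _ ≤ q ^ 2 + lam ^ 2 / b := avoidProb_two_mul_le ha ha1 hK hb hba (K i)
        _ ≤ q ^ 2 * (4 / b * lam ^ 2 + 1) := by
            have : (1 : ℝ) ≤ q ^ 2 * 4 := by nlinarith
            have h4 : lam ^ 2 / b ≤ q ^ 2 * 4 * (lam ^ 2 / b) :=
              le_mul_of_one_le_left (by positivity) this
            calc _ ≤ q ^ 2 + q ^ 2 * 4 * (lam ^ 2 / b) := by linarith
              _ = _ := by ring
        _ ≤ _ := by
            gcongr
            exact Real.add_one_le_exp _
    have h2 : avoidProb a K P (2 * K i) ^ (n - 2) ≤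
        q ^ (2 * (n - 2)) * Real.exp (4 / b * (L ^ 2 / n)) := by
      calc _ ≤ (q ^ 2 * Real.exp (4 / b * lam ^ 2)) ^ (n - 2) :=
            pow_le_pow_left₀ (avoidProb_nonneg ha _) h1 _
        _ = q ^ (2 * (n - 2)) * Real.exp ((n - 2 : ℕ) * (4 / b * lam ^ 2)) := by
            rw [mul_pow, ← pow_mul, Real.exp_nat_mul]
        _ ≤ _ := by
            refine mul_le_mul_of_nonneg_left (Real.exp_le_exp.2 ?_) (by positivity)
            calc ((n - 2 : ℕ) : ℝ) * (4 / b * lam ^ 2) ≤ n * (4 / b * lam ^ 2) := by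
                  gcongr
                  exact Nat.sub_le _ _
              _ = 4 / b * (n * lam ^ 2) := by ring
              _ ≤ _ := by gcongr
    -- A pair faces n - 2 outside nodes, a single node n - 1; the leftover q² produces the
    -- denominator (1 - L/n)².
    have h3 : μ ^ 2 = n ^ 2 * (q ^ (2 * (n - 2)) * q ^ 2 * a i ^ 2) := by
      rw [hμ, ← pow_add, show 2 * (n - 2) + 2 = (n - 1) * 2 by omega, pow_mul]
      ring
    calc _ ≤ (n : ℝ) ^ 2 * ((q ^ (2 * (n - 2)) * Real.exp (4 / b * (L ^ 2 / n))) * a i ^ 2) /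
          μ ^ 2 := by gcongr
      _ = Real.exp (4 / b * (L ^ 2 / n)) / q ^ 2 := by
          rw [h3]; field_simp
      _ ≤ _ := by
          have h5 : 1 - L / n ≤ q := by linarith
          have h6 : 0 < 1 - L / n := by linarith
          gcongr
  linarith

end

theorem tendsto_connProb_zero {m : ℕ} {a : Fin m → ℝ} (ha : ∀ i, 0 < a i)
    (ha1 : ∑ i, a i = 1) {P : ℕ → ℕ} {K : ℕ → Fin m → ℕ} (i : Fin m) {β : ℕ → ℝ}
    (hK : ∀ n, 1 ≤ n → ∀ i, K n i ≤ P n)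
    (hβ : ∀ n : ℕ, 1 ≤ n → 1 - avoidProb a (K n) (P n) (K n i) = (Real.log n + β n) / n)
    (hβt : Tendsto β atTop atBot) :
    Tendsto (fun n => connProb n a (K n) (P n)) atTop (𝓝 0) := by
  have : Nonempty (Fin m) := ⟨i⟩
  obtain ⟨i0, hi0⟩ := Finite.exists_min a
  have hlog : ∀ j : ℕ, Tendsto (fun n : ℕ => Real.log n ^ j / n) atTop (𝓝 0) := by
    intro j
    have h := (tendsto_pow_mul_exp_neg_mul j one_pos).comp tendsto_log_natCast
    refine h.congr' ?_
    filter_upwards [eventually_ge_atTop 1] with n hn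
    have hn0 : (0 : ℝ) < n := by exact_mod_cast hn
    simp only [Function.comp_apply, one_mul]
    rw [Real.exp_neg, Real.exp_log hn0, div_eq_mul_inv]
  have hlog1 : Tendsto (fun n : ℕ => Real.log n / n) atTop (𝓝 0) := by simpa using hlog 1
  have hlog2 := hlog 2
  have hbound : Tendsto (fun n : ℕ => Real.exp (β n + 2 * (Real.log n ^ 2 / n)) / a i +
      Real.exp (4 / a i0 * (Real.log n ^ 2 / n)) / (1 - Real.log n / n) ^ 2 - 1) atTop (𝓝 0) := by
    have h1 : Tendsto (fun n : ℕ => Real.exp (β n + 2 * (Real.log n ^ 2 / n)) / a i) atTop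
        (𝓝 0) := by
      have h := (Real.tendsto_exp_atBot.comp
        (hβt.atBot_add (hlog2.const_mul 2))).div_const (a i)
      rwa [zero_div] at h
    have h2 : Tendsto (fun n : ℕ => Real.exp (4 / a i0 * (Real.log n ^ 2 / n)) /
        (1 - Real.log n / n) ^ 2) atTop (𝓝 1) := by
      have h3 := (Real.continuous_exp.tendsto _).comp (hlog2.const_mul (4 / a i0))
      have h4 := ((tendsto_const_nhds (x := (1 : ℝ))).sub hlog1).pow 2
      have h5 := h3.div h4 (by norm_num)
      simp only [mul_zero, Real.exp_zero, sub_zero, one_pow, div_one] at h5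
      exact h5
    simpa using (h1.add h2).sub_const 1
  refine squeeze_zero' ?_ ?_ hbound
  · exact Eventually.of_forall fun n => prob_nonneg ha _
  · filter_upwards [eventually_ge_atTop 2, hβt.eventually_le_atBot 0,
      hlog1.eventually_le_const (show (0 : ℝ) < 1 / 2 by norm_num)] with n hn hβn hLn
    exact connProb_le_exp hn ha ha1 (hK n (by omega)) (ha i0) hi0 i
      (Real.exp_log (by positivity)) (hβ n (by omega)) hβn hLn

end RandomKeyGraph

/-! ### The zero-one law -/

theorem theorem1
    (m : ℕ) (hm : 0 < m)
    (a : Fin m → ℝ) (ha_pos : ∀ i, 0 < a i) (ha_sum : ∑ i, a i = 1)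
    (P : ℕ → ℕ) (K : ℕ → Fin m → ℕ)
    (hK_range : ∀ n, 1 ≤ n → ∀ i, 1 ≤ K n i ∧ K n i ≤ P n)
    (hK_mono : ∀ n, 1 ≤ n → Monotone (K n))
    (hP : (fun n : ℕ => (n : ℝ)) =O[atTop] fun n : ℕ => (P n : ℝ))
    (hK_first : (fun n : ℕ => √((P n : ℝ) / (n : ℝ))) =o[atTop]
      fun n : ℕ => (K n ⟨0, hm⟩ : ℝ))
    (hK_last : (fun n : ℕ => (K n ⟨m - 1, Nat.sub_one_lt_of_lt hm⟩ : ℝ)) =o[atTop]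
      fun n : ℕ => √(P n : ℝ))
    (β : ℕ → ℝ)
    (hβ : ∀ n : ℕ, 1 ≤ n →
      ∑ j, a j * (1 - ((P n - K n ⟨0, hm⟩).choose (K n j) : ℝ) / ((P n).choose (K n j) : ℝ))
        = (Real.log n + β n) / n) :
    (Tendsto β atTop atBot →
      Tendsto (fun n => RandomKeyGraph.connProb n a (K n) (P n)) atTop (𝓝 0)) ∧
    (Tendsto β atTop atTop →
      Tendsto (fun n => RandomKeyGraph.connProb n a (K n) (P n)) atTop (𝓝 1)) := by
  have hK : ∀ n, 1 ≤ n → ∀ i, K n i ≤ P n := fun n hn i => (hK_range n hn i).2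
  have hβ' : ∀ n : ℕ, 1 ≤ n →
      1 - RandomKeyGraph.avoidProb a (K n) (P n) (K n ⟨0, hm⟩) = (Real.log n + β n) / n := by
    intro n hn
    rw [← hβ n hn]
    exact (RandomKeyGraph.sum_mul_one_sub_missProb ha_sum).symm
  refine ⟨RandomKeyGraph.tendsto_connProb_zero ha_pos ha_sum ⟨0, hm⟩ hK hβ', fun hβt => ?_⟩
  obtain ⟨C, hC, hCP⟩ := hP.exists_pos
  have hPpos : ∀ n, 1 ≤ n → 0 < P n := fun n hn =>
    (hK_range n hn ⟨0, hm⟩).1.trans (hK n hn ⟨0, hm⟩)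
  refine RandomKeyGraph.tendsto_connProb_one hm ha_pos ha_sum
    (fun n hn => (hK_range n hn ⟨0, hm⟩).1) (fun n hn i => hK_mono n hn (Nat.zero_le _)) hK
    (inv_pos.2 hC) ?_ (RandomKeyGraph.tendsto_sq_mul_div hPpos hK_first) ?_ hβ' hβt
  · filter_upwards [hCP.bound] with n hn
    rw [Real.norm_natCast, Real.norm_natCast] at hn
    rwa [inv_mul_le_iff₀ hC]
  -- The largest ring size being o(√P) enters only through k² ≤ P for the smallest one.
  · filter_upwards [hK_last.bound one_pos, eventually_ge_atTop 1] with n hn hn1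
    rw [Real.norm_natCast, Real.norm_of_nonneg (Real.sqrt_nonneg _), one_mul] at hn
    have h1 : (K n ⟨0, hm⟩ : ℝ) ≤ K n ⟨m - 1, Nat.sub_one_lt_of_lt hm⟩ := by
      exact_mod_cast hK_mono n hn1 (Nat.zero_le _)
    exact (Real.le_sqrt (by positivity) (by positivity)).1 (h1.trans hn)
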